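/- \textbf{Environment.} Fix $A\ge 1$ arms, a horizon $T$, a number $N_T\ge 0$ of change-points, and $1=\nu_0<\nu_1<\dots<\nu_{N_T}<\nu_{N_T+1}=T+1$. In the rounds $\nu_{k-1},\dots,\nu_k-1$ (the $k$-th interval, $1\le k\le N_T+1$) the reward of arm $a$ has a fixed $\sigma^2$-sub-Gaussian law with mean $\mu_{a,k}$; rewards are independent over rounds and arms. Assume that the gaps $\Delta_{a,k}=\max_b\mu_{b,k}-\mu_{a,k}$ are at most $C$ and that $\max_a|\mu_{a,k+1}-\mu_{a,k}|\ge\underline\Delta_{\mathrm c}>0$ for $1\le k\le N_T$. The regret of a procedure that pulls $a_t$ in round $t$ is $R_T=\mathbb E\big[\sum_{k=1}^{N_T+1}\sum_{t=\nu_{k-1}}^{\nu_k-1}\Delta_{a_t,k}\big]$. \textbf{Bandit algorithm.} $\mathcal B$ maps a history of (arm, reward) pairs, possibly with independent internal randomization, to an arm. Let $R_{\mathcal B}$ be a concave nondecreasing function on $[1,\infty)$ such that, for each integer $n\ge 1$, the expected regret of $\mathcal B$ over $n$ rounds is at most $R_{\mathcal B}(n)$ on every stationary $\sigma^2$-sub-Gaussian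 instance with $A$ arms whose suboptimality gaps are at most $C$. \textbf{Change detector.} $\mathcal D$ maps a finite list of samples to a decision (alarm or no alarm); on a sequence $X_1,X_2,\dots$ let $\tau$ be the first $n\ge1$ such that there is an alarm on $X_1,\dots,X_n$. Let $\delta_{\mathrm F},\delta_{\mathrm D}\in(0,1)$. It is required that $\mathbb P_\infty(\tau\le T)\le\delta_{\mathrm F}$ for i.i.d. samples with any $\sigma^2$-sub-Gaussian law. For $\Delta>0$ let $m(\Delta)$ be the pre-change window, and let $d(\Delta)$ be the latency \[\inf\{t\in\{1,\dots,T\}:\ \mathbb P_\nu(\tau\ge\nu+t)\le\delta_{\mathrm D}\ \text{ for all }\nu\in\{m(\Delta)+1,\dots,T-t\}\}\] or any larger integer, where $\mathbb P_\nu$ ranges over all laws of independent samples with one $\sigma^2$-sub-Gaussian law before time $\nu$ and another one from time $\nu$ on, whose means differ by exactly $\Delta$. Assume that $m$ and $d$ are nonincreasing in $\Delta$. \textbf{DAB procedure.} Let $\alpha_k\in(0,1)$ for $k\ge1$. Start with $k=1$, last restart time $0$ and empty histories. In round $t$, with last restart time $s$, let $r=(t-s-1)\bmod\lceil A/\alpha_k\rceil$.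 If $r<A$ (forced exploration), pull arm $r+1$ and append its reward to the detector history of that arm; if $\mathcal D$ raises an alarm on this history, set the last restart time to $t$, empty all histories and increase $k$ by one. Otherwise pull the arm that $\mathcal B$ chooses from its own history, and append the pair (arm, reward) to that history. \textbf{Theorem.} Put $d_0=0$, and $m_k=\lceil A/\alpha_k\rceil\, m(\underline\Delta_{\mathrm c})$, $d_k=\lceil A/\alpha_k\rceil\, d(\underline\Delta_{\mathrm c})$ for $k\ge1$, and $\bar\alpha=\max_{1\le k\le N_T+1}\alpha_k$. If $d_{k-1}+m_k\le\nu_k-\nu_{k-1}$ for all $1\le k\le N_T$, then the regret of the DAB procedure satisfies \[R_T\le CTA(N_T+1)\delta_{\mathrm F}+CTN_T\delta_{\mathrm D}+(N_T+1)R_{\mathcal B}\Big(\frac{T}{N_T+1}\Big)+C\sum_{k=1}^{N_T}d_k+C\big[\bar\alpha T+(N_T+1)A\big].\] -/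

import Mathlib

open MeasureTheory ProbabilityTheory
open scoped NNReal

noncomputable section

namespace DAB

/-! ### Reward laws -/

/-- The mean of a reward law. -/
def mean (P : ProbabilityMeasure ℝ) : ℝ := ∫ x, x ∂(P : Measure ℝ)

/-- `P` is `σ²`-sub-Gaussian: after centring, its cumulant generating function is at most
`σ² θ² / 2` for every real `θ`. -/
def IsSubGaussian (σ : ℝ≥0) (P : ProbabilityMeasure ℝ) : Prop :=
  HasSubgaussianMGF (fun x : ℝ => x - mean P) (σ ^ 2) (P : Measure ℝ)

/-- Suboptimality gap of arm `a` when the arms have reward laws `P`. -/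
def gap {A : ℕ} (P : Fin A → ProbabilityMeasure ℝ) (a : Fin A) : ℝ :=
  (⨆ b, mean (P b)) - mean (P a)

/-! ### Randomness of a bandit environment -/

/-- One realization: for each round `t = 1, 2, …` the rewards `X_{a,t}` of all the arms, and a seed
for the internal randomization of the bandit algorithm (entry `0` is never used). -/
abbrev Outcome (A : ℕ) : Type := ℕ → (Fin A → ℝ) × unitInterval

/-- The joint law when arm `a` has reward law `P t a` in round `t`: all rewards (over arms and
rounds) and all the uniform seeds are independent. -/
def outcomeLaw {A : ℕ} (P : ℕ → Fin A → ProbabilityMeasure ℝ) : Measure (Outcome A) :=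
  Measure.infinitePi fun t =>
    (Measure.pi fun a => (P t a : Measure ℝ)).prod (volume : Measure unitInterval)

/-! ### Stationary bandit algorithms -/

/-- A (possibly randomized) bandit algorithm: it maps the list of (arm, reward) pairs seen so far,
in chronological order, and a seed to the arm that is pulled next. -/
structure BanditAlgorithm (A : ℕ) where
  act : List (Fin A × ℝ) → unitInterval → Fin A
  measurable_act : ∀ n : ℕ, Measurable fun p : (Fin n → Fin A × ℝ) × unitInterval =>
    act (List.ofFn p.1) p.2

/-- History of the algorithm after `n` rounds when it runs on its own. -/
def BanditAlgorithm.history {A : ℕ} (B : BanditAlgorithm A) (ω : Outcome A) :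
    ℕ → List (Fin A × ℝ)
  | 0 => []
  | n + 1 =>
      B.history ω n ++
        [(B.act (B.history ω n) (ω (n + 1)).2, (ω (n + 1)).1 (B.act (B.history ω n) (ω (n + 1)).2))]

/-- Expected regret over `n` rounds of the algorithm on the stationary instance `P`. -/
def BanditAlgorithm.stationaryRegret {A : ℕ} (B : BanditAlgorithm A)
    (P : Fin A → ProbabilityMeasure ℝ) (n : ℕ) : ℝ :=
  ∫ ω, ∑ t ∈ Finset.Icc 1 n, gap P (B.act (B.history ω (t - 1)) (ω t).2) ∂(outcomeLaw fun _ => P)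

/-- `RB` is a concave and nondecreasing bound for the regret of `B`, uniformly over all stationary
`σ²`-sub-Gaussian instances whose suboptimality gaps are at most `C`. -/
structure HasRegretBound {A : ℕ} (B : BanditAlgorithm A) (σ : ℝ≥0) (C : ℝ) (RB : ℝ → ℝ) :
    Prop where
  concave : ConcaveOn ℝ (Set.Ici 1) RB
  mono : MonotoneOn RB (Set.Ici 1)
  bound : ∀ P : Fin A → ProbabilityMeasure ℝ, (∀ a, IsSubGaussian σ (P a)) → (∀ a, gap P a ≤ C) →
    ∀ n : ℕ, 1 ≤ n → B.stationaryRegret P n ≤ RB n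

/-! ### Change detectors -/

/-- A change detector: it maps the samples observed so far, in chronological order, to its
decision (`true`: a change is declared). -/
structure ChangeDetector where
  alarm : List ℝ → Bool
  measurable_alarm : ∀ n : ℕ, Measurable fun x : Fin n → ℝ => alarm (List.ofFn x)

/-- The stopping time of the detector on the sequence `x 1, x 2, …` (entry `0` is never used). -/
def ChangeDetector.stoppingTime (D : ChangeDetector) (x : ℕ → ℝ) : ℕ∞ :=
  ⨅ (n : ℕ) (_ : 1 ≤ n ∧ D.alarm (List.ofFn fun i : Fin n => x (i + 1)) = true), (n : ℕ∞)

/-- Law of independent samples with law `f₀` before time `ν` and law `f₁` from time `ν` on. -/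
def changeLaw (f₀ f₁ : ProbabilityMeasure ℝ) (ν : ℕ) : Measure (ℕ → ℝ) :=
  Measure.infinitePi fun n => ((if n < ν then f₀ else f₁ : ProbabilityMeasure ℝ) : Measure ℝ)

/-- Law of independent samples with law `f₀`: there is no change. -/
def noChangeLaw (f₀ : ProbabilityMeasure ℝ) : Measure (ℕ → ℝ) :=
  Measure.infinitePi fun _ => (f₀ : Measure ℝ)

/-- The latency of the detector over the horizon `M`, for the pre-change window `m` and a mean-shift
of size `Δ`, at level `δD`: the least `t ∈ {1, …, M}` such that the change is declared within `t`
samples with probability at least `1 - δD`, for each deterministic change-point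
`ν ∈ {m + 1, …, M - t}` and whatever the `σ²`-sub-Gaussian laws before and after the change. -/
def ChangeDetector.latency (D : ChangeDetector) (σ : ℝ≥0) (δD : ℝ) (M m : ℕ) (Δ : ℝ) : ℕ :=
  sInf {t : ℕ | t ∈ Set.Icc 1 M ∧ ∀ ν ∈ Set.Icc (m + 1) (M - t), ∀ f₀ f₁ : ProbabilityMeasure ℝ,
    IsSubGaussian σ f₀ → IsSubGaussian σ f₁ → |mean f₀ - mean f₁| = Δ →
      (changeLaw f₀ f₁ ν).real {x | ((ν + t : ℕ) : ℕ∞) ≤ D.stoppingTime x} ≤ δD}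

/-- The requirements on a detector with levels `δF`, `δD` over the horizon `M`; `m Δ` is its
pre-change window and `d Δ` is its latency (or a larger number) for mean-shifts of size `Δ`. -/
structure MeetsRequirements (D : ChangeDetector) (σ : ℝ≥0) (δF δD : ℝ) (M : ℕ) (m d : ℝ → ℕ) :
    Prop where
  falseAlarm : ∀ f₀ : ProbabilityMeasure ℝ, IsSubGaussian σ f₀ →
    (noChangeLaw f₀).real {x | D.stoppingTime x ≤ (M : ℕ∞)} ≤ δF
  latency_le : ∀ Δ : ℝ, 0 < Δ → D.latency σ δD M (m Δ) Δ ≤ d Δ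
  antitone_window : AntitoneOn m (Set.Ioi 0)
  antitone_latency : AntitoneOn d (Set.Ioi 0)

/-! ### Piecewise stationary environments -/

/-- A piecewise stationary environment with `A` arms, `N` change-points and horizon `T`: the
change-points satisfy `1 = ν 0 < ν 1 < ⋯ < ν N < ν (N + 1) = T + 1`, and for `k = 1, …, N + 1` the
rewards of arm `a` in the rounds `ν (k - 1), …, ν k - 1` have the `σ²`-sub-Gaussian law `law k a`
(other values of `ν` and `law` are irrelevant). -/
structure Environment (A N T : ℕ) (σ : ℝ≥0) where
  ν : ℕ → ℕ
  ν_zero : ν 0 = 1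
  ν_lt : ∀ k ≤ N, ν k < ν (k + 1)
  ν_last : ν (N + 1) = T + 1
  law : ℕ → Fin A → ProbabilityMeasure ℝ
  subGaussian : ∀ k ∈ Set.Icc 1 (N + 1), ∀ a, IsSubGaussian σ (law k a)

variable {A N T : ℕ} {σ : ℝ≥0}

/-- The index of the stationary interval that contains round `t`. -/
def Environment.interval (E : Environment A N T σ) (t : ℕ) : ℕ :=
  ((Finset.range (N + 1)).filter fun j => E.ν j ≤ t).card

/-- The change-gap at the `k`-th change-point: the largest mean-shift over the arms. -/
def Environment.changeGap (E : Environment A N T σ) (k : ℕ) : ℝ :=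
  ⨆ a, |mean (E.law (k + 1) a) - mean (E.law k a)|

/-- Law of the rewards and the seeds in the environment. -/
def Environment.outcomeLaw (E : Environment A N T σ) : Measure (Outcome A) :=
  DAB.outcomeLaw fun t => E.law (E.interval t)

/-! ### The DAB procedure -/

/-- State of the procedure: time of the last restart, index of the current interval between
restarts, detector history of each arm, history of the bandit algorithm. -/
structure State (A : ℕ) where
  restart : ℕ
  k : ℕ
  histD : Fin A → List ℝ
  histB : List (Fin A × ℝ)

/-- The period `⌈A / α⌉` of the forced exploration with frequency `α`. -/
def period (A : ℕ) (α : ℝ) : ℕ := ⌈(A : ℝ) / α⌉₊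

/-- Position of round `t` in its exploration period; the round is one of forced exploration iff this
is less than `A`, and it is then the arm to pull (arms are numbered from `0`). -/
def phase (α : ℕ → ℝ) (s : State A) (t : ℕ) : ℕ := (t - s.restart - 1) % period A (α s.k)

/-- The arm pulled in round `t` from state `s`, with seed `u`. -/
def pull (B : BanditAlgorithm A) (α : ℕ → ℝ) (s : State A) (t : ℕ) (u : unitInterval) : Fin A :=
  if h : phase α s t < A then ⟨phase α s t, h⟩ else B.act s.histB u

/-- Update of the state in round `t`, with rewards `X` and seed `u`. A forced-exploration reward
goes to the detector history of its arm, and an alarm of the detector restarts everything; any other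
reward goes to the history of the bandit algorithm. -/
def step (B : BanditAlgorithm A) (D : ChangeDetector) (α : ℕ → ℝ) (s : State A) (t : ℕ)
    (X : Fin A → ℝ) (u : unitInterval) : State A :=
  let a := pull B α s t u
  if phase α s t < A then
    if D.alarm (s.histD a ++ [X a]) = true then
      { restart := t, k := s.k + 1, histD := fun _ => [], histB := [] }
    else
      { s with histD := Function.update s.histD a (s.histD a ++ [X a]) }
  else
    { s with histB := s.histB ++ [(a, X a)] }

/-- State of the procedure after `t` rounds. -/
def state (B : BanditAlgorithm A) (D : ChangeDetector) (α : ℕ → ℝ) (ω : Outcome A) : ℕ → State A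
  | 0 => { restart := 0, k := 1, histD := fun _ => [], histB := [] }
  | t + 1 => step B D α (state B D α ω t) (t + 1) (ω (t + 1)).1 (ω (t + 1)).2

/-- The arm `a_t` pulled by the procedure in round `t ≥ 1`. -/
def armAt (B : BanditAlgorithm A) (D : ChangeDetector) (α : ℕ → ℝ) (ω : Outcome A) (t : ℕ) :
    Fin A :=
  pull B α (state B D α ω (t - 1)) t (ω t).2

/-- Expected dynamic regret over the horizon `T` of the DAB procedure in the environment `E`. -/
def regret (E : Environment A N T σ) (B : BanditAlgorithm A) (D : ChangeDetector) (α : ℕ → ℝ) : ℝ :=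
  ∫ ω, ∑ k ∈ Finset.Icc 1 (N + 1), ∑ t ∈ Finset.Ico (E.ν (k - 1)) (E.ν k),
    gap (E.law k) (armAt B D α ω t) ∂E.outcomeLaw

/-- `m_k = ⌈A / α_k⌉ m`: the pre-change window of the procedure at the `k`-th change-point, where
`m` is the pre-change window of the detector. -/
def windowAt (A : ℕ) (α : ℕ → ℝ) (m k : ℕ) : ℕ := period A (α k) * m

/-- `d_k = ⌈A / α_k⌉ d` for `k ≥ 1`, and `d_0 = 0`: the latency of the procedure at the `k`-th
change-point, where `d` is the latency of the detector. -/
def latencyAt (A : ℕ) (α : ℕ → ℝ) (d k : ℕ) : ℕ := if k = 0 then 0 else period A (α k) * d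

/-- The largest of the exploration frequencies `α 1, …, α (N + 1)`. -/
def maxFreq (α : ℕ → ℝ) (N : ℕ) : ℝ :=
  (Finset.Icc 1 (N + 1)).sup' (Finset.nonempty_Icc.2 (Nat.le_add_left 1 N)) α

end DAB

end

/-!
The regret of a realization is bounded pathwise by a sum of terms, each of which is a function of
the rounds after some restart, and these terms are then integrated one by one.

Between two alarms the procedure has no feedback from the detectors: after a restart at time `s`,
the rounds of forced exploration, the samples they collect and the rounds left to the bandit
algorithm are deterministic, up to the first alarm (`state_eq`). Hence the event `restartEvent k s`
that the `k`-th restart takes place at time `s` depends on the rounds up to `s` only, whereas the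
events `falseAlarm` (an alarm before the next change) and `missedChange` (no alarm within the latency
after the next change) and the regret `banditRegret` of the bandit algorithm until the next change
can be defined by the rounds after `s` only, for a *deterministic* `s`. Independence of past and
future, together with the disjointness of the events `restartEvent k s` for different `s`, then
replaces conditioning on a random restart time (`integral_sum_restart_le`).

For deterministic `s` in the `k`-th interval, a false alarm has probability at most `A * δF`, because
the samples of each arm until the next change are i.i.d. (`real_falseAlarm_le`). The missed
change has probability at most `δD` (`real_missedChange_le`): the samples of the arm with the largest
mean-shift have exactly one change of law, the separation condition provides the pre-change window
and every arm is sampled once per period. The bandit algorithm meets a stationary instance for a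
deterministic number of rounds, at most the length of the interval (`integral_banditRegret_le`).

If no restart is followed by one of the bad events, then by induction each interval contains a
restart within the latency after its beginning (`exists_restart`), and the regret of the interval
consists of the rounds before that restart, the forced exploration and `banditRegret`
(`interval_regret_le`). Otherwise the trivial bound `C * T` is used; `sum_regret_le` combines the
two cases. Summing over the intervals and applying Jensen's inequality to the concave function `RB`
gives the result. If the latency after the last change exceeds the horizon, that change need not
be detected, as the whole last interval is then paid for by the latency term.
-/

noncomputable section

namespace DAB

/-! ### Functions of finitely many coordinates of a product measure -/

section ProductMeasure

variable {X Y β : Type*} [MeasurableSpace X] [MeasurableSpace Y] [MeasurableSpace β]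

/-- The sequence that agrees with `x` on the finite set `S` and is constant elsewhere. -/
def extendFrom [Nonempty Y] (S : Finset ℕ) (x : S → Y) : ℕ → Y :=
  fun i => if h : i ∈ S then x ⟨i, h⟩ else Classical.arbitrary Y

theorem measurable_extendFrom [Nonempty Y] (S : Finset ℕ) :
    Measurable (extendFrom (Y := Y) S) := by
  refine measurable_pi_lambda _ fun i => ?_
  by_cases h : i ∈ S
  · simpa [extendFrom, h] using measurable_pi_apply _
  · simp [extendFrom, h]

theorem eq_extendFrom_of_dependsOn {Y β : Type*} [Nonempty Y] {S : Finset ℕ} {F : (ℕ → Y) → β}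
    (hF : DependsOn F (S : Set ℕ)) (y : ℕ → Y) : F y = F (extendFrom S fun i : S => y i) :=
  hF fun i hi => by
    have hi' : i ∈ S := hi
    simp [extendFrom, hi']

/-- Coordinates of an independent sequence, read off along an injective sequence of indices and
mapped by `f`, have the law of an independent sequence with the corresponding marginals, as far as
functions of finitely many coordinates are concerned. -/
theorem map_infinitePi_reindex [Nonempty Y] (μ : ℕ → Measure X) [∀ i, IsProbabilityMeasure (μ i)]
    (ρ : ℕ → Measure Y) [∀ i, IsProbabilityMeasure (ρ i)] {f : X → Y} (hf : Measurable f)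
    {S : Finset ℕ} {e : ℕ → ℕ} (he : Set.InjOn e S) (hρ : ∀ i ∈ S, (μ (e i)).map f = ρ i)
    {F : (ℕ → Y) → β} (hF : Measurable F) (hFS : DependsOn F (S : Set ℕ)) :
    (Measure.infinitePi μ).map (fun ω => F fun i => f (ω (e i))) =
      (Measure.infinitePi ρ).map F := by
  have hX : (Measure.infinitePi μ).map (fun ω (i : S) => f (ω (e i))) =
      Measure.pi fun i : S => ρ i := by
    have h1 : iIndepFun (fun (i : S) (ω : ℕ → X) => f (ω (e i))) (Measure.infinitePi μ) :=
      (iIndepFun_infinitePi (P := μ) (X := fun _ => f) fun _ => hf).precomp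
        (g := fun i : S => e i) fun i j hij => Subtype.ext (he i.2 j.2 hij)
    rw [(iIndepFun_iff_map_fun_eq_pi_map fun i => by
      exact (hf.comp (measurable_pi_apply (e i))).aemeasurable).1 h1]
    congr 1
    ext1 i
    rw [← hρ i i.2, ← Measure.infinitePi_map_eval μ (e i), Measure.map_map hf (by fun_prop)]
    rfl
  have hY : (Measure.infinitePi ρ).map (fun ω (i : S) => ω i) = Measure.pi fun i : S => ρ i := by
    have h1 : iIndepFun (fun (i : S) (ω : ℕ → Y) => ω i) (Measure.infinitePi ρ) :=
      (iIndepFun_infinitePi (P := ρ) (X := fun _ => id) fun _ => measurable_id).precomp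
        (g := fun i : S => (i : ℕ)) Subtype.val_injective
    rw [(iIndepFun_iff_map_fun_eq_pi_map fun i => (measurable_pi_apply _).aemeasurable).1 h1]
    congr 1
    ext1 i
    exact Measure.infinitePi_map_eval ρ i
  have e1 : (fun ω : ℕ → X => F fun i => f (ω (e i))) =
      (F ∘ extendFrom S) ∘ fun ω (i : S) => f (ω (e i)) :=
    funext fun ω => eq_extendFrom_of_dependsOn hFS _
  have e2 : F = (F ∘ extendFrom S) ∘ fun ω (i : S) => ω i :=
    funext fun ω => eq_extendFrom_of_dependsOn hFS _
  have hm := hF.comp (measurable_extendFrom (Y := Y) S)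
  rw [e1, ← Measure.map_map hm (by fun_prop), hX]
  conv_rhs => rw [e2]
  rw [← Measure.map_map hm (by fun_prop), hY]

/-- Functions of disjoint finite sets of coordinates of an independent sequence are independent. -/
theorem indepFun_infinitePi_of_dependsOn [Nonempty X] (μ : ℕ → Measure X)
    [∀ i, IsProbabilityMeasure (μ i)] {S S' : Finset ℕ} (hS : Disjoint S S')
    {F : (ℕ → X) → β} {G : (ℕ → X) → Y} (hF : Measurable F) (hFS : DependsOn F (S : Set ℕ))
    (hG : Measurable G) (hGS : DependsOn G (S' : Set ℕ)) :
    IndepFun F G (Measure.infinitePi μ) := by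
  have h1 : iIndepFun (fun (i : ℕ) (ω : ℕ → X) => ω i) (Measure.infinitePi μ) :=
    iIndepFun_infinitePi (P := μ) (X := fun _ => id) fun _ => measurable_id
  have h2 := (h1.indepFun_finset S S' hS fun i => measurable_pi_apply i).comp
    (hF.comp (measurable_extendFrom S)) (hG.comp (measurable_extendFrom S'))
  have e1 : F = (F ∘ extendFrom S) ∘ fun ω (i : S) => ω i :=
    funext fun ω => eq_extendFrom_of_dependsOn hFS _
  have e2 : G = (G ∘ extendFrom S') ∘ fun ω (i : S') => ω i :=
    funext fun ω => eq_extendFrom_of_dependsOn hGS _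
  rw [e1, e2]
  exact h2

theorem dependsOn_indicator {X : Type*} {S : Set (ℕ → X)} {I : Set ℕ}
    (h : DependsOn (fun ω => ω ∈ S) I) : DependsOn (S.indicator (1 : (ℕ → X) → ℝ)) I :=
  fun x y hxy => by
    have : x ∈ S ↔ y ∈ S := iff_of_eq (h hxy)
    by_cases hx : x ∈ S
    · rw [Set.indicator_of_mem hx, Set.indicator_of_mem (this.1 hx)]; rfl
    · rw [Set.indicator_of_notMem hx, Set.indicator_of_notMem fun h => hx (this.2 h)]

/-- An event and a function of disjoint finite sets of coordinates of an independent sequence. -/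
theorem integral_indicator_mul_of_dependsOn [Nonempty X] (μ : ℕ → Measure X)
    [∀ i, IsProbabilityMeasure (μ i)] {S S' : Finset ℕ} (hS : Disjoint S S')
    {R : Set (ℕ → X)} {g : (ℕ → X) → ℝ} (hR : MeasurableSet R)
    (hRS : DependsOn (fun ω => ω ∈ R) (S : Set ℕ)) (hg : Measurable g)
    (hgS : DependsOn g (S' : Set ℕ)) :
    ∫ ω, R.indicator 1 ω * g ω ∂(Measure.infinitePi μ) =
      (Measure.infinitePi μ).real R * ∫ ω, g ω ∂(Measure.infinitePi μ) := by
  have hm : Measurable (R.indicator (1 : (ℕ → X) → ℝ)) := measurable_one.indicator hR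
  have h := (indepFun_infinitePi_of_dependsOn μ hS hm (dependsOn_indicator hRS)
    hg hgS).integral_mul_eq_mul_integral
    hm.aestronglyMeasurable hg.aestronglyMeasurable
  rw [integral_indicator_one hR] at h
  exact h

end ProductMeasure

/-! ### Counting the rounds of an exploration period -/

theorem count_mod_eq {P : ℕ} (hP : 0 < P) {a : ℕ} (ha : a < P) (n : ℕ) :
    Nat.count (fun j => j % P = a) n = n / P + if a < n % P then 1 else 0 := by
  have h := Nat.count_modEq_card n hP a
  rw [Nat.mod_eq_of_lt ha] at h
  rw [← h]
  congr 1
  ext x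
  rw [Nat.ModEq, Nat.mod_eq_of_lt ha]

theorem count_mod_lt {P A : ℕ} (hP : 0 < P) (hA : A ≤ P) (n : ℕ) :
    Nat.count (fun j => j % P < A) n ≤ A * (n / P + 1) := by
  have h : Nat.count (fun j => j % P < A) n =
      ∑ a ∈ Finset.range A, Nat.count (fun j => j % P = a) n := by
    induction n with
    | zero => simp
    | succ n ih =>
      simp only [Nat.count_succ, Finset.sum_add_distrib, ih]
      simp
  rw [h]
  calc _ ≤ ∑ a ∈ Finset.range A, (n / P + 1) := by
        refine Finset.sum_le_sum fun a ha => ?_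
        rw [count_mod_eq hP (by have := Finset.mem_range.1 ha; omega)]
        split_ifs <;> omega
    _ = _ := by simp

theorem lt_count_mod_iff {P : ℕ} (hP : 0 < P) {a : ℕ} (ha : a < P) (i n : ℕ) :
    i < Nat.count (fun j => j % P = a) n ↔ a + i * P < n := by
  rw [count_mod_eq hP ha]
  have h := Nat.div_add_mod n P
  have h2 := Nat.mod_lt n hP
  generalize n / P = q at *
  generalize n % P = r at *
  constructor
  · intro hi
    rcases Nat.lt_or_ge i q with h3 | h3
    · have : (i + 1) * P ≤ q * P := Nat.mul_le_mul_right _ h3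
      nlinarith
    · split_ifs at hi with h4
      · have : i = q := by omega
        subst this
        nlinarith
      · omega
  · intro hi
    by_contra hc
    rcases Nat.lt_or_ge q i with h3 | h3
    · have : (q + 1) * P ≤ i * P := Nat.mul_le_mul_right _ h3
      nlinarith
    · split_ifs at hc with h4
      · omega
      · have : i = q := by omega
        subst this
        nlinarith

theorem count_mod_add_mul {P : ℕ} (hP : 0 < P) {a : ℕ} (ha : a < P) (n t : ℕ) :
    Nat.count (fun j => j % P = a) (n + P * t) = Nat.count (fun j => j % P = a) n + t := by
  rw [count_mod_eq hP ha, count_mod_eq hP ha, Nat.add_mul_div_left _ _ hP,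
    Nat.add_mul_mod_self_left]
  omega

theorem infinite_setOf_le_mod {P A : ℕ} (hA : A < P) : {j | A ≤ j % P}.Infinite := by
  refine Set.infinite_of_forall_exists_gt fun n => ⟨A + P * (n + 1), ?_, ?_⟩
  · simp [Nat.add_mul_mod_self_left, Nat.mod_eq_of_lt hA]
  · nlinarith

/-! ### The procedure between two restarts -/

section Path

variable {A : ℕ}

/-- The `i`-th reward (from `0`) that forced exploration with period `P` collects from arm `a` after
a restart at time `s`. -/
def sample (P s : ℕ) (a : Fin A) (ω : Outcome A) (i : ℕ) : ℝ := (ω (s + 1 + (a + i * P))).1 a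

/-- The first `n` of these rewards, in chronological order. -/
def samples (P s : ℕ) (a : Fin A) (ω : Outcome A) (n : ℕ) : List ℝ :=
  List.ofFn fun i : Fin n => sample P s a ω i

/-- The event that, after a restart at time `s` and with exploration period `P`, round `s + 1 + j`
is one of forced exploration and the detector history it completes raises an alarm. An alarm between
`s` and this round is not excluded: the histories are those of a procedure that ignores alarms. -/
def alarmEvent (D : ChangeDetector) (P s j : ℕ) : Set (Outcome A) :=
  {ω | ∃ a : Fin A, j % P = a ∧ D.alarm (samples P s a ω (j / P + 1)) = true}

/-- The event that the procedure restarts for the `k`-th time at time `s`, where the start of the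
procedure counts as the restart with number `0` and takes place at time `0`. -/
def restartEvent (D : ChangeDetector) (α : ℕ → ℝ) : ℕ → ℕ → Set (Outcome A)
  | 0, s => {_ω | s = 0}
  | k + 1, s => {ω | ∃ s' j, s = s' + 1 + j ∧ ω ∈ restartEvent D α k s' ∧
      ω ∈ alarmEvent D (period A (α (k + 1))) s' j ∧
      ∀ i < j, ω ∉ alarmEvent D (period A (α (k + 1))) s' i}

/-- The `i`-th round (from `1`) that is left to the bandit algorithm after a restart at time `s`,
when the exploration period is `P`. -/
def banditRound (A P s i : ℕ) : ℕ := s + 1 + Nat.nth (fun j => A ≤ j % P) (i - 1)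

/-- The rewards and seeds of the rounds left to the bandit algorithm after a restart at time `s`, as
an outcome for the algorithm running on its own (entry `0` is never used). -/
def banditOutcome (P s : ℕ) (ω : Outcome A) : Outcome A := fun i => ω (banditRound A P s i)

/-- The arm that the algorithm pulls in round `t` when it runs on its own. -/
def BanditAlgorithm.arm (B : BanditAlgorithm A) (ω : Outcome A) (t : ℕ) : Fin A :=
  B.act (B.history ω (t - 1)) (ω t).2

theorem lt_period (hA : 0 < A) {α : ℝ} (hα : α ∈ Set.Ioo (0 : ℝ) 1) : A < period A α := by
  have h : (A : ℝ) < A / α := by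
    rw [lt_div_iff₀ hα.1]
    have : (0 : ℝ) < A := by exact_mod_cast hA
    nlinarith [hα.2]
  exact_mod_cast h.trans_le (Nat.le_ceil _)

/-- The forced-exploration rounds among the first `n` rounds after a restart. -/
theorem forced_count_le {α : ℝ} (hα : α ∈ Set.Ioo (0 : ℝ) 1) (hA : 0 < A) (n : ℕ) :
    (Nat.count (fun j => j % period A α < A) n : ℝ) ≤ α * n + A := by
  have hP := lt_period hA hα
  have h1 : (Nat.count (fun j => j % period A α < A) n : ℝ) ≤ A * ((n / period A α : ℕ) + 1) := by
    exact_mod_cast count_mod_lt (by omega) hP.le n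
  have h2 : (A : ℝ) ≤ α * period A α := by
    have := Nat.le_ceil ((A : ℝ) / α)
    rwa [div_le_iff₀ hα.1, mul_comm] at this
  have h3 : ((n / period A α : ℕ) : ℝ) * period A α ≤ n := by
    exact_mod_cast Nat.div_mul_le_self n _
  have h4 : (0 : ℝ) ≤ ((n / period A α : ℕ) : ℝ) := by positivity
  have h5 := hα.1
  nlinarith [mul_le_mul_of_nonneg_right h2 h4, mul_le_mul_of_nonneg_left h3 h5.le]

theorem samples_succ {P s : ℕ} (hP : 0 < P) (ω : Outcome A) {n : ℕ} (h : n % P < A) :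
    samples P s ⟨n % P, h⟩ ω (Nat.count (fun j => j % P = n % P) n) ++
      [(ω (s + n + 1)).1 ⟨n % P, h⟩] = samples P s ⟨n % P, h⟩ ω (n / P + 1) := by
  have hc : Nat.count (fun j => j % P = n % P) n = n / P := by
    rw [count_mod_eq hP (Nat.mod_lt n hP)]; simp
  have e : s + 1 + (n % P + n / P * P) = s + n + 1 := by
    have := Nat.mod_add_div n P
    rw [mul_comm] at this
    omega
  rw [hc, samples, samples, List.ofFn_succ', List.concat_eq_append]
  simp [sample, e]

theorem step_of_forced (B : BanditAlgorithm A) (D : ChangeDetector) (α : ℕ → ℝ) (s : State A)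
    (t : ℕ) (X : Fin A → ℝ) (u : unitInterval) {r : ℕ} (hr : phase α s t = r) (h : r < A) :
    step B D α s t X u =
      if D.alarm (s.histD ⟨r, h⟩ ++ [X ⟨r, h⟩]) = true then ⟨t, s.k + 1, fun _ => [], []⟩
      else { s with histD := Function.update s.histD ⟨r, h⟩ (s.histD ⟨r, h⟩ ++ [X ⟨r, h⟩]) } := by
  subst hr
  simp only [step, pull, dif_pos h, if_pos h]

theorem step_of_not_forced (B : BanditAlgorithm A) (D : ChangeDetector) (α : ℕ → ℝ) (s : State A)
    (t : ℕ) (X : Fin A → ℝ) (u : unitInterval) (h : ¬ phase α s t < A) :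
    step B D α s t X u =
      { s with histB := s.histB ++ [(B.act s.histB u, X (B.act s.histB u))] } := by
  simp only [step, pull, dif_neg h, if_neg h]

/-- Until the next alarm, the state after a restart at time `s` is an explicit function of the
rewards and seeds of the rounds after `s`. -/
theorem state_eq (B : BanditAlgorithm A) (D : ChangeDetector) (α : ℕ → ℝ) (ω : Outcome A)
    {s k : ℕ} (hP : A < period A (α k))
    (hs : state B D α ω s = ⟨s, k, fun _ => [], []⟩) (n : ℕ)
    (hn : ∀ j < n, ω ∉ alarmEvent D (period A (α k)) s j) :
    state B D α ω (s + n) = ⟨s, k,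
      fun a => samples (period A (α k)) s a ω (Nat.count (fun j => j % period A (α k) = a) n),
      B.history (banditOutcome (period A (α k)) s ω)
        (Nat.count (fun j => A ≤ j % period A (α k)) n)⟩ := by
  induction n with
  | zero => simpa [BanditAlgorithm.history, samples] using hs
  | succ n ih =>
    specialize ih fun j hj => hn j (by omega)
    have hna := hn n (by omega)
    rw [← add_assoc, state, ih]
    have hph : (s + n + 1 - s - 1) % period A (α k) = n % period A (α k) := by
      congr 1; omega
    generalize hPdef : period A (α k) = P at *
    by_cases h : n % P < A
    · rw [step_of_forced B D α _ _ _ _ (r := n % P) (by rw [phase, hPdef, hph]) h]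
      simp only
      rw [samples_succ (by omega) ω h, if_neg fun hc => hna ⟨⟨n % P, h⟩, rfl, hc⟩,
        Nat.count_succ (fun j => A ≤ j % P), if_neg (by omega), add_zero]
      congr 1
      funext a
      rw [Nat.count_succ]
      by_cases ha : a = ⟨n % P, h⟩
      · subst ha
        rw [Function.update_self, if_pos rfl, count_mod_eq (by omega) (by omega)]
        simp
      · rw [Function.update_of_ne ha, if_neg fun h => ha (Fin.ext h.symm), add_zero]
    · have hr : banditRound A P s (Nat.count (fun j => A ≤ j % P) n + 1) = s + n + 1 := by
        rw [banditRound, Nat.add_sub_cancel, Nat.nth_count (p := fun j => A ≤ j % P) (by omega)]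
        omega
      rw [step_of_not_forced B D α _ _ _ _ (by rw [phase, hPdef, hph]; exact h),
        Nat.count_succ (fun j => A ≤ j % P), if_pos (by omega), BanditAlgorithm.history]
      simp only [banditOutcome, hr]
      congr 1
      funext a
      rw [Nat.count_succ, if_neg fun h' : n % P = a => h (h'.symm ▸ a.2), add_zero]

theorem state_eq_of_alarm (B : BanditAlgorithm A) (D : ChangeDetector) (α : ℕ → ℝ) (ω : Outcome A)
    {s k : ℕ} (hP : A < period A (α k))
    (hs : state B D α ω s = ⟨s, k, fun _ => [], []⟩) {n : ℕ}
    (hn : ∀ j < n, ω ∉ alarmEvent D (period A (α k)) s j)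
    (ha : ω ∈ alarmEvent D (period A (α k)) s n) :
    state B D α ω (s + 1 + n) = ⟨s + 1 + n, k + 1, fun _ => [], []⟩ := by
  have e0 : s + 1 + n = s + n + 1 := by omega
  rw [e0, state, state_eq B D α ω hP hs n hn]
  have hph : (s + n + 1 - s - 1) % period A (α k) = n % period A (α k) := by
    congr 1; omega
  generalize hPdef : period A (α k) = P at *
  obtain ⟨a, haP, hal⟩ := ha
  have h : n % P < A := haP ▸ a.2
  obtain rfl : a = ⟨n % P, h⟩ := Fin.ext haP.symm
  rw [step_of_forced B D α _ _ _ _ (r := n % P) (by rw [phase, hPdef, hph]) h]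
  simp only
  rw [samples_succ (by omega) ω h, if_pos hal]

theorem state_of_mem_restartEvent (B : BanditAlgorithm A) (D : ChangeDetector) (α : ℕ → ℝ)
    (hP : ∀ k, 1 ≤ k → A < period A (α k)) {ω : Outcome A} :
    ∀ {k s : ℕ}, ω ∈ restartEvent D α k s → state B D α ω s = ⟨s, k + 1, fun _ => [], []⟩
  | 0, s, h => by
    obtain rfl : s = 0 := h
    rfl
  | k + 1, s, h => by
    obtain ⟨s', j, rfl, h1, h2, h3⟩ := h
    exact state_eq_of_alarm B D α ω (hP _ (by omega)) (state_of_mem_restartEvent B D α hP h1) h3 h2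

theorem restartEvent_unique {D : ChangeDetector} {α : ℕ → ℝ} {ω : Outcome A} :
    ∀ {k s s' : ℕ}, ω ∈ restartEvent D α k s → ω ∈ restartEvent D α k s' → s = s'
  | 0, s, s', h, h' => Eq.trans (b := 0) h (Eq.symm h')
  | k + 1, s, s', h, h' => by
    obtain ⟨u, j, rfl, h1, h2, h3⟩ := h
    obtain ⟨u', j', rfl, h1', h2', h3'⟩ := h'
    obtain rfl := restartEvent_unique h1 h1'
    rcases lt_trichotomy j j' with h | h | h
    · exact absurd h2 (h3' _ h)
    · rw [h]
    · exact absurd h2' (h3 _ h)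

/-- The arm pulled in the round `s + 1 + n` when there was no alarm since the restart at time
`s`, if the round is left to the bandit algorithm. -/
theorem armAt_eq (B : BanditAlgorithm A) (D : ChangeDetector) (α : ℕ → ℝ) (ω : Outcome A)
    {s k : ℕ} (hP : A < period A (α k))
    (hs : state B D α ω s = ⟨s, k, fun _ => [], []⟩) {n : ℕ}
    (hn : ∀ j < n, ω ∉ alarmEvent D (period A (α k)) s j) (hb : A ≤ n % period A (α k)) :
    armAt B D α ω (s + 1 + n) = B.arm (banditOutcome (period A (α k)) s ω)
      (Nat.count (fun j => A ≤ j % period A (α k)) n + 1) := by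
  have e0 : s + 1 + n - 1 = s + n := by omega
  rw [armAt, e0, state_eq B D α ω hP hs n hn]
  have hph : s + 1 + n - s - 1 = n := by omega
  simp only [pull, phase, hph]
  rw [dif_neg (by omega), BanditAlgorithm.arm, Nat.add_sub_cancel, banditOutcome, banditRound,
    Nat.add_sub_cancel, Nat.nth_count (p := fun j => A ≤ j % period A (α k)) hb]

/-- Regret of the rounds `s + 1, …, s + n` after a restart at time `s`, if there is no alarm before
the last of them: a forced-exploration round costs at most `C`, and the others are those of the
bandit algorithm running on its own. -/
theorem sum_gap_le (B : BanditAlgorithm A) (D : ChangeDetector) (α : ℕ → ℝ) (ω : Outcome A)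
    {s k : ℕ} (hP : A < period A (α k))
    (hs : state B D α ω s = ⟨s, k, fun _ => [], []⟩) {n : ℕ}
    (hn : ∀ j < n, ω ∉ alarmEvent D (period A (α k)) s j) (g : Fin A → ℝ) {C : ℝ}
    (hg : ∀ a, g a ≤ C) :
    ∑ j ∈ Finset.range n, g (armAt B D α ω (s + 1 + j)) ≤
      C * Nat.count (fun j => j % period A (α k) < A) n +
      ∑ i ∈ Finset.Icc 1 (Nat.count (fun j => A ≤ j % period A (α k)) n),
        g (B.arm (banditOutcome (period A (α k)) s ω) i) := by
  induction n with
  | zero => simp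
  | succ n ih =>
    have ih := ih fun j hj => hn j (by omega)
    rw [Finset.sum_range_succ]
    by_cases h : n % period A (α k) < A
    · rw [Nat.count_succ, Nat.count_succ, if_pos h, if_neg (by omega)]
      push_cast
      have := hg (armAt B D α ω (s + 1 + n))
      simp only [add_zero]
      linarith
    · rw [Nat.count_succ, Nat.count_succ, if_neg h, if_pos (by omega),
        Finset.sum_Icc_succ_top (by omega),
        armAt_eq B D α ω hP hs (fun j hj => hn j (by omega)) (by omega)]
      simp only [add_zero]
      linarith

/-! ### Measurability, and the rounds on which the events depend -/

theorem measurable_sample (P s : ℕ) (a : Fin A) (i : ℕ) :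
    Measurable fun ω : Outcome A => sample P s a ω i := by
  unfold sample; fun_prop

theorem measurableSet_alarmEvent (D : ChangeDetector) (P s j : ℕ) :
    MeasurableSet (alarmEvent (A := A) D P s j) := by
  have : alarmEvent (A := A) D P s j = ⋃ a : Fin A, {ω | j % P = a ∧
      D.alarm (samples P s a ω (j / P + 1)) = true} := by
    ext ω; simp [alarmEvent]
  rw [this]
  refine MeasurableSet.iUnion fun a => (MeasurableSet.const _).inter ?_
  exact ((D.measurable_alarm (j / P + 1)).comp (measurable_pi_lambda _ fun i =>
    measurable_sample P s a i)) (measurableSet_singleton true)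

theorem measurableSet_restartEvent (D : ChangeDetector) (α : ℕ → ℝ) :
    ∀ k s : ℕ, MeasurableSet (restartEvent (A := A) D α k s)
  | 0, s => MeasurableSet.const _
  | k + 1, s => by
    have : restartEvent (A := A) D α (k + 1) s = ⋃ (s') (j), {_ω | s = s' + 1 + j} ∩
        (restartEvent D α k s' ∩ (alarmEvent D (period A (α (k + 1))) s' j ∩
        ⋂ i, ⋂ (_ : i < j), (alarmEvent D (period A (α (k + 1))) s' i)ᶜ)) := by
      ext ω; simp [restartEvent]
    rw [this]
    exact MeasurableSet.iUnion fun s' => MeasurableSet.iUnion fun j =>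
      (MeasurableSet.const _).inter ((measurableSet_restartEvent D α k s').inter
        ((measurableSet_alarmEvent D _ s' j).inter (MeasurableSet.iInter fun i =>
          MeasurableSet.iInter fun _ => (measurableSet_alarmEvent D _ s' i).compl)))

theorem dependsOn_alarmEvent (D : ChangeDetector) (P s j : ℕ) :
    DependsOn (fun ω => ω ∈ alarmEvent (A := A) D P s j) (Set.Ioc s (s + 1 + j)) := by
  intro x y hxy
  have h : ∀ a : Fin A, j % P = a → ∀ i : Fin (j / P + 1), sample P s a x i = sample P s a y i := by
    intro a ha i
    rw [sample, sample, hxy]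
    have h1 := Nat.mod_add_div j P
    have h2 : (i : ℕ) * P ≤ j / P * P := Nat.mul_le_mul_right _ (by omega)
    rw [mul_comm] at h1
    exact ⟨by omega, by omega⟩
  simp only [alarmEvent, Set.mem_ofPred_eq, eq_iff_iff]
  refine exists_congr fun a => and_congr_right fun ha => ?_
  rw [samples, samples, funext (h a ha)]

theorem dependsOn_restartEvent (D : ChangeDetector) (α : ℕ → ℝ) :
    ∀ k s : ℕ, DependsOn (fun ω => ω ∈ restartEvent (A := A) D α k s) (Set.Iic s)
  | 0, s => fun _ _ _ => rfl
  | k + 1, s => fun x y hxy => by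
    simp only [restartEvent, Set.mem_ofPred_eq, eq_iff_iff]
    refine exists_congr fun s' => exists_congr fun j => and_congr_right fun hs => ?_
    have h1 : x ∈ restartEvent D α k s' ↔ y ∈ restartEvent D α k s' :=
      iff_of_eq (dependsOn_restartEvent D α k s' fun i hi => hxy i (by
        simp only [Set.mem_Iic] at hi ⊢; omega))
    have h2 : ∀ i ≤ j, (x ∈ alarmEvent D (period A (α (k + 1))) s' i ↔
        y ∈ alarmEvent D (period A (α (k + 1))) s' i) := fun i hi =>
      iff_of_eq (dependsOn_alarmEvent D _ s' i fun l hl => hxy l (by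
        simp only [Set.mem_Iic, Set.mem_Ioc] at hl ⊢; omega))
    rw [h1, h2 j le_rfl]
    refine and_congr_right fun _ => and_congr_right fun _ => forall_congr' fun i =>
      imp_congr_right fun hi => ?_
    rw [h2 i hi.le]

/-! ### The bandit algorithm running on its own -/

theorem BanditAlgorithm.exists_measurable_history (B : BanditAlgorithm A) (n : ℕ) :
    ∃ h : Outcome A → Fin n → Fin A × ℝ, Measurable h ∧ ∀ ω, B.history ω n = List.ofFn (h ω) := by
  induction n with
  | zero => exact ⟨fun _ i => i.elim0, measurable_pi_lambda _ fun i => i.elim0, fun ω => by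
      simp [BanditAlgorithm.history]⟩
  | succ n ih =>
    obtain ⟨h, hm, hh⟩ := ih
    have ha : Measurable fun ω : Outcome A => B.act (List.ofFn (h ω)) (ω (n + 1)).2 :=
      (B.measurable_act n).comp (hm.prodMk (by fun_prop))
    have hr : Measurable fun ω : Outcome A =>
        (ω (n + 1)).1 (B.act (List.ofFn (h ω)) (ω (n + 1)).2) := by
      have : Measurable fun p : (Fin A → ℝ) × Fin A => p.1 p.2 :=
        measurable_from_prod_countable_left fun a => measurable_pi_apply a
      exact this.comp (Measurable.prodMk (by fun_prop) ha)
    refine ⟨fun ω => Fin.snoc (α := fun _ => Fin A × ℝ) (h ω)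
      (B.act (List.ofFn (h ω)) (ω (n + 1)).2,
        (ω (n + 1)).1 (B.act (List.ofFn (h ω)) (ω (n + 1)).2)), ?_, fun ω => ?_⟩
    · refine measurable_pi_lambda _ fun i => ?_
      refine Fin.lastCases ?_ (fun i => ?_) i
      · simpa using ha.prodMk hr
      · simpa using measurable_pi_iff.1 hm i
    · rw [List.ofFn_succ', List.concat_eq_append]
      simp [BanditAlgorithm.history, hh]

theorem BanditAlgorithm.measurable_arm (B : BanditAlgorithm A) (t : ℕ) :
    Measurable fun ω => B.arm ω t := by
  obtain ⟨h, hm, hh⟩ := B.exists_measurable_history (t - 1)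
  simp only [BanditAlgorithm.arm, hh]
  exact (B.measurable_act (t - 1)).comp (hm.prodMk (by fun_prop))

theorem BanditAlgorithm.dependsOn_history (B : BanditAlgorithm A) (n : ℕ) :
    DependsOn (fun ω => B.history ω n) (Set.Icc 1 n) := by
  induction n with
  | zero => exact fun _ _ _ => rfl
  | succ n ih =>
    intro x y hxy
    have h1 : B.history x n = B.history y n := ih fun i hi => hxy i ⟨hi.1, hi.2.trans n.le_succ⟩
    have h2 : x (n + 1) = y (n + 1) := hxy _ ⟨by omega, le_rfl⟩
    simp only [BanditAlgorithm.history, h1, h2]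

theorem BanditAlgorithm.dependsOn_arm (B : BanditAlgorithm A) {t : ℕ} (ht : 1 ≤ t) :
    DependsOn (fun ω => B.arm ω t) (Set.Icc 1 t) := by
  intro x y hxy
  have h1 : B.history x (t - 1) = B.history y (t - 1) :=
    B.dependsOn_history _ fun i hi => hxy i ⟨hi.1, hi.2.trans (Nat.sub_le _ _)⟩
  simp only [BanditAlgorithm.arm, h1, hxy t ⟨ht, le_rfl⟩]

end Path

/-! ### Gaps and stationary intervals -/

section Env

variable {A N T : ℕ} {σ : ℝ≥0}

theorem gap_nonneg (P : Fin A → ProbabilityMeasure ℝ) (a : Fin A) : 0 ≤ gap P a :=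
  sub_nonneg.2 (le_ciSup (f := fun b => mean (P b)) (Set.finite_range _).bddAbove a)

theorem BanditAlgorithm.pos (B : BanditAlgorithm A) : 0 < A := (B.act [] 0).pos

theorem Environment.ν_mono (E : Environment A N T σ) {j k : ℕ} (hjk : j ≤ k) (hk : k ≤ N + 1) :
    E.ν j ≤ E.ν k := by
  induction k, hjk using Nat.le_induction with
  | base => exact le_rfl
  | succ k _ ih => exact (ih (by omega)).trans (E.ν_lt k (by omega)).le

theorem Environment.interval_eq (E : Environment A N T σ) {k t : ℕ} (hk : k ≤ N)
    (h1 : E.ν k ≤ t) (h2 : t < E.ν (k + 1)) : E.interval t = k + 1 := by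
  have : (Finset.range (N + 1)).filter (fun j => E.ν j ≤ t) = Finset.range (k + 1) := by
    ext j
    simp only [Finset.mem_filter, Finset.mem_range]
    constructor
    · rintro ⟨h3, h4⟩
      by_contra hc
      have := E.ν_mono (j := k + 1) (k := j) (by omega) (by omega)
      omega
    · intro h3
      exact ⟨by omega, (E.ν_mono (by omega) (by omega)).trans h1⟩
  rw [Environment.interval, this, Finset.card_range]

theorem Environment.one_le_ν (E : Environment A N T σ) {k : ℕ} (hk : k ≤ N + 1) : 1 ≤ E.ν k :=
  E.ν_zero ▸ E.ν_mono (Nat.zero_le k) hk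

theorem Environment.ν_le (E : Environment A N T σ) {k : ℕ} (hk : k ≤ N + 1) : E.ν k ≤ T + 1 :=
  E.ν_last ▸ E.ν_mono hk le_rfl

instance (P : ℕ → Fin A → ProbabilityMeasure ℝ) : IsProbabilityMeasure (outcomeLaw P) := by
  unfold outcomeLaw; infer_instance

instance (E : Environment A N T σ) : IsProbabilityMeasure E.outcomeLaw := by
  unfold Environment.outcomeLaw; infer_instance

instance (f₀ f₁ : ProbabilityMeasure ℝ) (ν : ℕ) : IsProbabilityMeasure (changeLaw f₀ f₁ ν) := by
  unfold changeLaw; infer_instance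

instance (f₀ : ProbabilityMeasure ℝ) : IsProbabilityMeasure (noChangeLaw f₀) := by
  unfold noChangeLaw; infer_instance

/-! ### False alarms and missed changes -/

/-- The event that the detector raises an alarm within the first `n` samples. -/
def ChangeDetector.alarmWithin (D : ChangeDetector) (n : ℕ) : Set (ℕ → ℝ) :=
  {x | ∃ i ∈ Set.Icc 1 n, D.alarm (List.ofFn fun l : Fin i => x (l + 1)) = true}

theorem ChangeDetector.measurableSet_alarmWithin (D : ChangeDetector) (n : ℕ) :
    MeasurableSet (D.alarmWithin n) := by
  have : D.alarmWithin n = ⋃ i ∈ Set.Icc 1 n,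
      {x | D.alarm (List.ofFn fun l : Fin i => x (l + 1)) = true} := by
    ext x; simp [ChangeDetector.alarmWithin]
  rw [this]
  refine MeasurableSet.biUnion (Set.to_countable _) fun i _ => ?_
  exact ((D.measurable_alarm i).comp (measurable_pi_lambda _ fun l => measurable_pi_apply _))
    (measurableSet_singleton true)

theorem ChangeDetector.dependsOn_alarmWithin (D : ChangeDetector) (n : ℕ) :
    DependsOn (fun x => x ∈ D.alarmWithin n) (Finset.Icc 1 n : Finset ℕ) := by
  intro x y hxy
  simp only [ChangeDetector.alarmWithin, Set.mem_ofPred_eq, eq_iff_iff]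
  refine exists_congr fun i => and_congr_right fun hi => ?_
  have : (fun l : Fin i => x (l + 1)) = fun l : Fin i => y (l + 1) := funext fun l =>
    hxy _ (by simp only [Finset.coe_Icc, Set.mem_Icc] at hi ⊢; omega)
  rw [this]

theorem ChangeDetector.stoppingTime_le_of_mem (D : ChangeDetector) {n M : ℕ} (hn : n ≤ M)
    {x : ℕ → ℝ} (hx : x ∈ D.alarmWithin n) : D.stoppingTime x ≤ (M : ℕ∞) := by
  obtain ⟨i, hi, hal⟩ := hx
  exact (iInf₂_le i ⟨hi.1, hal⟩).trans (by exact_mod_cast hi.2.trans hn)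

theorem ChangeDetector.le_stoppingTime_of_notMem (D : ChangeDetector) {n : ℕ}
    {x : ℕ → ℝ} (hx : x ∉ D.alarmWithin n) : ((n + 1 : ℕ) : ℕ∞) ≤ D.stoppingTime x := by
  refine le_iInf₂ fun i hi => ?_
  have : n < i := by
    by_contra hc
    exact hx ⟨i, ⟨hi.1, by omega⟩, hi.2⟩
  exact_mod_cast this

/-- The rewards that forced exploration collects from arm `a`, numbered from `1`. -/
def sampleSeq (P s : ℕ) (a : Fin A) (ω : Outcome A) : ℕ → ℝ := fun i => sample P s a ω (i - 1)

/-- An alarm among the first `n` rounds after a restart is an alarm of the detector of one of the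
arms on the samples that forced exploration takes from it during these rounds. -/
theorem exists_alarmEvent_iff (D : ChangeDetector) {P : ℕ} (hP : A < P) (s n : ℕ)
    (ω : Outcome A) : (∃ j < n, ω ∈ alarmEvent D P s j) ↔
      ∃ a : Fin A, sampleSeq P s a ω ∈ D.alarmWithin (Nat.count (fun j => j % P = a) n) := by
  constructor
  · rintro ⟨j, hj, a, ha, hal⟩
    refine ⟨a, j / P + 1, ⟨Nat.le_add_left 1 _, ?_⟩, hal⟩
    rw [Nat.succ_le_iff, lt_count_mod_iff (by omega) (by omega), ← ha, mul_comm, Nat.mod_add_div]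
    exact hj
  · rintro ⟨a, i, ⟨hi1, hi2⟩, hal⟩
    obtain ⟨i, rfl⟩ : ∃ l, i = l + 1 := ⟨i - 1, by omega⟩
    have ha : (a : ℕ) < P := a.2.trans hP
    refine ⟨a + i * P, (lt_count_mod_iff (by omega) ha i n).1 (by omega), a, ?_, ?_⟩
    · rw [Nat.add_mul_mod_self_right, Nat.mod_eq_of_lt ha]
    · rw [Nat.add_mul_div_right _ _ (by omega), Nat.div_eq_of_lt ha, zero_add]
      exact hal

theorem map_reward (P : Fin A → ProbabilityMeasure ℝ) (a : Fin A) :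
    (((Measure.pi fun a => (P a : Measure ℝ)).prod (volume : Measure unitInterval)).map
      fun x => x.1 a) = (P a : Measure ℝ) :=
  ((measurePreserving_eval (fun a => (P a : Measure ℝ)) a).comp measurePreserving_fst).map_eq

/-- The probability of an alarm within the first `n` samples of arm `a` is that for independent
samples with the laws in force in the rounds where these samples are taken. -/
theorem Environment.real_sampleSeq (E : Environment A N T σ) (D : ChangeDetector) {P : ℕ}
    (hP : 0 < P) (s : ℕ) (a : Fin A) (n : ℕ) (ρ : ℕ → ProbabilityMeasure ℝ)
    (hρ : ∀ i < n, E.law (E.interval (s + 1 + (a + i * P))) a = ρ (i + 1)) :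
    MeasurableSet {ω | sampleSeq P s a ω ∈ D.alarmWithin n} ∧
    E.outcomeLaw.real {ω | sampleSeq P s a ω ∈ D.alarmWithin n} =
      (Measure.infinitePi fun i => (ρ i : Measure ℝ)).real (D.alarmWithin n) := by
  have hF : Measurable fun x => x ∈ D.alarmWithin n :=
    measurableSet_setOfPred.1 (D.measurableSet_alarmWithin n)
  have hseq : Measurable fun ω => sampleSeq P s a ω :=
    measurable_pi_lambda _ fun i => measurable_sample P s a (i - 1)
  have h : E.outcomeLaw.map ((· ∈ D.alarmWithin n) ∘ fun ω => sampleSeq P s a ω) =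
      (Measure.infinitePi fun i => (ρ i : Measure ℝ)).map (· ∈ D.alarmWithin n) :=
    map_infinitePi_reindex (S := Finset.Icc 1 n)
    (fun t => (Measure.pi fun a => (E.law (E.interval t) a : Measure ℝ)).prod
      (volume : Measure unitInterval)) (fun i => (ρ i : Measure ℝ))
    (f := fun x => x.1 a) (by fun_prop) (e := fun i => s + 1 + (a + (i - 1) * P))
    (fun i hi j hj hij => by
      simp only [Finset.coe_Icc, Set.mem_Icc] at hi hj
      have : (i - 1) * P = (j - 1) * P := by simp only at hij; omega
      have := Nat.eq_of_mul_eq_mul_right hP this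
      omega)
    (fun i hi => by
      rw [Finset.mem_Icc] at hi
      rw [map_reward, hρ (i - 1) (by omega), Nat.sub_add_cancel hi.1])
    hF (D.dependsOn_alarmWithin n)
  refine ⟨hseq (D.measurableSet_alarmWithin n), ?_⟩
  have h2 := congrArg (fun ν : Measure Prop => ν {p | p}) h
  beta_reduce at h2
  rw [Measure.map_apply (hF.comp hseq) (MeasurableSet.of_discrete),
    Measure.map_apply hF (MeasurableSet.of_discrete)] at h2
  exact congrArg ENNReal.toReal h2

/-- The event that, after a restart at time `s`, there is an alarm before the end of the `k`-th
stationary interval (from `0`), that is, before round `E.ν (k + 1)`. -/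
def falseAlarm (E : Environment A N T σ) (D : ChangeDetector) (P k s : ℕ) : Set (Outcome A) :=
  {ω | ∃ j < E.ν (k + 1) - 1 - s, ω ∈ alarmEvent D P s j}

/-- The event that, after a restart at time `s` in the `k`-th stationary interval (from `0`), there is
no alarm until `P * d` rounds of the next interval are over. -/
def missedChange (E : Environment A N T σ) (D : ChangeDetector) (P d k s : ℕ) : Set (Outcome A) :=
  {ω | ∀ j < E.ν (k + 1) - 1 - s + P * d, ω ∉ alarmEvent D P s j}

theorem measurableSet_falseAlarm (E : Environment A N T σ) (D : ChangeDetector) (P k s : ℕ) :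
    MeasurableSet (falseAlarm E D P k s) := by
  have : falseAlarm E D P k s = ⋃ j ∈ Set.Iio (E.ν (k + 1) - 1 - s), alarmEvent D P s j := by
    ext ω; simp [falseAlarm]
  rw [this]
  exact MeasurableSet.biUnion (Set.to_countable _) fun j _ => measurableSet_alarmEvent D P s j

theorem measurableSet_missedChange (E : Environment A N T σ) (D : ChangeDetector)
    (P d k s : ℕ) : MeasurableSet (missedChange E D P d k s) := by
  have : missedChange E D P d k s =
      ⋂ j ∈ Set.Iio (E.ν (k + 1) - 1 - s + P * d), (alarmEvent D P s j)ᶜ := by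
    ext ω; simp [missedChange]
  rw [this]
  exact MeasurableSet.biInter (Set.to_countable _) fun j _ =>
    (measurableSet_alarmEvent D P s j).compl

theorem dependsOn_falseAlarm (E : Environment A N T σ) (D : ChangeDetector) (P : ℕ) {k : ℕ}
    (hk : k ≤ N) (s : ℕ) :
    DependsOn (fun ω => ω ∈ falseAlarm E D P k s) (Finset.Ioc s T : Finset ℕ) := by
  intro x y hxy
  have hν := E.ν_le (k := k + 1) (by omega)
  simp only [falseAlarm, Set.mem_ofPred_eq, eq_iff_iff]
  refine exists_congr fun j => and_congr_right fun hj => iff_of_eq ?_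
  refine dependsOn_alarmEvent D P s j fun i hi => hxy i ?_
  simp only [Finset.coe_Ioc, Set.mem_Ioc] at hi ⊢
  omega

theorem dependsOn_missedChange (E : Environment A N T σ) (D : ChangeDetector) (P d : ℕ) {k s : ℕ}
    (hs : s < E.ν (k + 1)) (hν : E.ν (k + 1) + P * d ≤ T + 1) :
    DependsOn (fun ω => ω ∈ missedChange E D P d k s) (Finset.Ioc s T : Finset ℕ) := by
  intro x y hxy
  simp only [missedChange, Set.mem_ofPred_eq, eq_iff_iff]
  refine forall_congr' fun j => imp_congr_right fun hj => not_congr (iff_of_eq ?_)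
  refine dependsOn_alarmEvent D P s j fun i hi => hxy i ?_
  simp only [Finset.coe_Ioc, Set.mem_Ioc] at hi ⊢
  omega

variable {δF δD : ℝ} {m d : ℝ → ℕ}

theorem real_falseAlarm_le (E : Environment A N T σ) {D : ChangeDetector}
    (hD : MeetsRequirements D σ δF δD T m d) {P : ℕ} (hP : A < P) {k s : ℕ} (hk : k ≤ N)
    (hs1 : E.ν k ≤ s + 1) : E.outcomeLaw.real (falseAlarm E D P k s) ≤ A * δF := by
  have hν := E.ν_le (k := k + 1) (by omega)
  set n := E.ν (k + 1) - 1 - s with hn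
  have hsub : falseAlarm E D P k s ⊆ ⋃ a : Fin A, {ω | sampleSeq P s a ω ∈
      D.alarmWithin (Nat.count (fun j => j % P = a) n)} := fun ω hω => by
    simpa using (exists_alarmEvent_iff D hP s n ω).1 hω
  refine (measureReal_mono hsub).trans ((measureReal_iUnion_fintype_le _).trans ?_)
  have : ∀ a : Fin A, E.outcomeLaw.real {ω | sampleSeq P s a ω ∈
      D.alarmWithin (Nat.count (fun j => j % P = a) n)} ≤ δF := fun a => by
    rw [(E.real_sampleSeq D (by omega) s a _ (fun _ => E.law (k + 1) a) fun i hi => ?_).2]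
    · refine le_trans (measureReal_mono fun x hx => ?_)
        (hD.falseAlarm _ (E.subGaussian (k + 1) ⟨by omega, by omega⟩ a))
      exact D.stoppingTime_le_of_mem ((Nat.count_le _).trans (by omega)) hx
    · rw [lt_count_mod_iff (by omega) (a.2.trans hP)] at hi
      rw [E.interval_eq hk (by omega) (by omega)]
  calc _ ≤ ∑ _a : Fin A, δF := Finset.sum_le_sum fun a _ => this a
    _ = _ := by simp

/-- The infimum in the definition of the latency is attained: its set contains `M`, for which there
is no change-point to consider. -/
theorem ChangeDetector.latency_mem (D : ChangeDetector) (σ : ℝ≥0) (δD : ℝ) {M : ℕ} (hM : 1 ≤ M)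
    (m : ℕ) (Δ : ℝ) : D.latency σ δD M m Δ ∈ {t : ℕ | t ∈ Set.Icc 1 M ∧
      ∀ ν ∈ Set.Icc (m + 1) (M - t), ∀ f₀ f₁ : ProbabilityMeasure ℝ,
      IsSubGaussian σ f₀ → IsSubGaussian σ f₁ → |mean f₀ - mean f₁| = Δ →
        (changeLaw f₀ f₁ ν).real {x | ((ν + t : ℕ) : ℕ∞) ≤ D.stoppingTime x} ≤ δD} := by
  refine Nat.sInf_mem ⟨M, ⟨hM, le_rfl⟩, fun ν hν => ?_⟩
  have := hν.1.trans hν.2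
  omega

/-- A change after which the detector has had its pre-change window is missed with probability at
most `δD`: the detector history of the arm with the largest mean-shift is a sequence of samples with
one change of law. -/
theorem real_missedChange_le (E : Environment A N T σ) {D : ChangeDetector}
    (hD : MeetsRequirements D σ δF δD T m d) (hA : 0 < A) {P : ℕ} (hP : A < P) {k s : ℕ}
    (hk : k < N) {Δ : ℝ} (hΔ : 0 < Δ) (hΔk : Δ ≤ E.changeGap (k + 1)) (hs1 : E.ν k ≤ s + 1)
    (hs2 : s + 1 + P * m Δ ≤ E.ν (k + 1)) (hd : E.ν (k + 1) + P * d Δ ≤ E.ν (k + 2)) :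
    E.outcomeLaw.real (missedChange E D P (d Δ) k s) ≤ δD := by
  have : Nonempty (Fin A) := ⟨⟨0, hA⟩⟩
  obtain ⟨a, ha⟩ := exists_eq_ciSup_of_finite
    (f := fun a => |mean (E.law (k + 1 + 1) a) - mean (E.law (k + 1) a)|)
  set Δ' := |mean (E.law (k + 1 + 1) a) - mean (E.law (k + 1) a)| with hΔ'
  have hΔΔ' : Δ ≤ Δ' := hΔk.trans_eq ha.symm
  have hΔ'0 : 0 < Δ' := hΔ.trans_le hΔΔ'
  have hT := E.ν_le (k := k + 2) (by omega)
  have hν1 := E.one_le_ν (k := k + 1) (by omega)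
  have hm : m Δ' ≤ m Δ := hD.antitone_window hΔ hΔ'0 hΔΔ'
  have hdd : d Δ' ≤ d Δ := hD.antitone_latency hΔ hΔ'0 hΔΔ'
  have hνν := E.ν_lt (k + 1) (by omega)
  have hνk := E.ν_lt k (by omega)
  have hν0 := E.one_le_ν (k := k) (by omega)
  obtain ⟨⟨ht1, htT⟩, hdet⟩ := D.latency_mem σ δD (M := T) (by omega) (m Δ') Δ'
  have htd := (hD.latency_le Δ' hΔ'0).trans hdd
  set t := D.latency σ δD T (m Δ') Δ'
  set n := E.ν (k + 1) - 1 - s with hn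
  have haP : (a : ℕ) < P := a.2.trans hP
  have hPt : P * t ≤ P * d Δ := Nat.mul_le_mul_left _ htd
  have hPt1 : P ≤ P * t := Nat.le_mul_of_pos_right _ ht1
  have hcount := count_mod_add_mul (by omega) haP n t
  set n₀ := Nat.count (fun j => j % P = a) n with hn₀
  have hmn : m Δ' ≤ n₀ := by
    have h0 : P * m Δ ≤ n := by omega
    have h1 := Nat.count_monotone (fun j => j % P = (a : ℕ)) h0
    have h2 := count_mod_add_mul (by omega) haP 0 (m Δ)
    simp only [zero_add, Nat.count_zero] at h2
    omega
  -- The samples needed for the detection are at most every other round apart.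
  have hnT : n₀ + 1 ≤ T - t := by
    have h1 : n₀ + t ≤ (n + P * t) / P + 1 := by
      rw [← hcount, count_mod_eq (by omega) haP]
      split_ifs <;> omega
    have h2 : (n + P * t) / P ≤ (n + P * t) / 2 := Nat.div_le_div_left (by omega) (by omega)
    omega
  have hρ : ∀ i < Nat.count (fun j => j % P = (a : ℕ)) (n + P * t),
      E.law (E.interval (s + 1 + (a + i * P))) a =
        if i + 1 < n₀ + 1 then E.law (k + 1) a else E.law (k + 2) a := fun i hi => by
    rw [lt_count_mod_iff (by omega) haP] at hi
    have hin := lt_count_mod_iff (by omega) haP i n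
    rw [← hn₀] at hin
    split_ifs with h
    · have := hin.1 (by omega)
      rw [E.interval_eq (k := k) (by omega) (by omega) (by omega)]
    · have : ¬ (a + i * P < n) := fun h' => h (by have := hin.2 h'; omega)
      have hd' : E.ν (k + 1) + P * d Δ ≤ E.ν (k + 1 + 1) := hd
      rw [E.interval_eq (k := k + 1) (by omega) (by omega) (by omega)]
  have hlaw := E.real_sampleSeq D (by omega) s a (n₀ + t)
    (fun i => if i < n₀ + 1 then E.law (k + 1) a else E.law (k + 2) a)
    (fun i hi => hρ i (by rw [hcount]; exact hi))
  have hsub : missedChange E D P (d Δ) k s ⊆ {ω | sampleSeq P s a ω ∈ D.alarmWithin (n₀ + t)}ᶜ := by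
    intro ω hω hal
    simp only [Set.mem_ofPred_eq] at hal
    rw [← hcount] at hal
    obtain ⟨j, hj, hj'⟩ := (exists_alarmEvent_iff D hP s (n + P * t) ω).2 ⟨a, hal⟩
    exact hω j (by omega) hj'
  refine (measureReal_mono hsub).trans ?_
  have h1 := hdet (n₀ + 1) ⟨by omega, hnT⟩ (E.law (k + 1) a) (E.law (k + 2) a)
    (E.subGaussian _ ⟨by omega, by omega⟩ a) (E.subGaussian _ ⟨by omega, by omega⟩ a)
    (abs_sub_comm _ _)
  refine le_trans ?_ h1
  rw [measureReal_compl hlaw.1, probReal_univ, hlaw.2, ← probReal_compl_eq_one_sub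
    (D.measurableSet_alarmWithin _)]
  refine measureReal_mono fun x hx => ?_
  have := D.le_stoppingTime_of_notMem hx
  rwa [show n₀ + t + 1 = n₀ + 1 + t by omega] at this

/-! ### The regret of the bandit algorithm between two restarts -/

/-- Regret of the bandit algorithm in the `k`-th interval (from `0`), after a restart at time `s`
and when alarms are ignored. -/
def banditRegret (E : Environment A N T σ) (B : BanditAlgorithm A) (P k s : ℕ) (ω : Outcome A) :
    ℝ :=
  ∑ i ∈ Finset.Icc 1 (Nat.count (fun j => A ≤ j % P) (E.ν (k + 1) - 1 - s)),
    gap (E.law (k + 1)) (B.arm (banditOutcome P s ω) i)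

theorem banditRegret_nonneg (E : Environment A N T σ) (B : BanditAlgorithm A) (P k s : ℕ)
    (ω : Outcome A) : 0 ≤ banditRegret E B P k s ω :=
  Finset.sum_nonneg fun _ _ => gap_nonneg _ _

theorem measurable_sum_gap_arm (B : BanditAlgorithm A) (P : Fin A → ProbabilityMeasure ℝ) (n : ℕ) :
    Measurable fun ω => ∑ i ∈ Finset.Icc 1 n, gap P (B.arm ω i) :=
  Finset.measurable_sum _ fun i _ => (measurable_of_countable (gap P)).comp (B.measurable_arm i)

theorem dependsOn_sum_gap_arm (B : BanditAlgorithm A) (P : Fin A → ProbabilityMeasure ℝ) (n : ℕ) :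
    DependsOn (fun ω => ∑ i ∈ Finset.Icc 1 n, gap P (B.arm ω i)) (Finset.Icc 1 n : Finset ℕ) :=
  fun x y hxy => Finset.sum_congr rfl fun i hi => by
    rw [Finset.mem_Icc] at hi
    have := B.dependsOn_arm hi.1 (x := x) (y := y) fun j hj => hxy j (by
      simp only [Finset.coe_Icc, Set.mem_Icc] at hj ⊢; omega)
    simp only at this
    rw [this]

theorem measurable_banditOutcome (P s : ℕ) :
    Measurable fun ω : Outcome A => banditOutcome P s ω :=
  measurable_pi_lambda _ fun _ => measurable_pi_apply _

theorem measurable_banditRegret (E : Environment A N T σ) (B : BanditAlgorithm A) (P k s : ℕ) :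
    Measurable (banditRegret E B P k s) :=
  (measurable_sum_gap_arm B (E.law (k + 1)) _).comp (measurable_banditOutcome P s)

theorem banditRound_lt {P s i n : ℕ} (hi : i ∈ Set.Icc 1 (Nat.count (fun j => A ≤ j % P) n)) :
    banditRound A P s i < s + 1 + n := by
  have hi1 := hi.1
  have hi2 := hi.2
  exact Nat.add_lt_add_left (Nat.nth_lt_of_lt_count (by omega)) _

theorem dependsOn_banditRegret (E : Environment A N T σ) (B : BanditAlgorithm A) (P : ℕ) {k : ℕ}
    (hk : k ≤ N) (s : ℕ) : DependsOn (banditRegret E B P k s) (Finset.Ioc s T : Finset ℕ) := by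
  intro x y hxy
  have hν := E.ν_le (k := k + 1) (by omega)
  refine dependsOn_sum_gap_arm B (E.law (k + 1)) _ fun i hi => hxy _ ?_
  rw [Finset.coe_Icc] at hi
  have h := banditRound_lt (s := s) hi
  have h2 : s + 1 ≤ banditRound A P s i := Nat.le_add_right _ _
  have h3 := hi.1.trans (hi.2.trans (Nat.count_le _))
  simp only [Finset.coe_Ioc, Set.mem_Ioc]
  omega

/-- Between two restarts inside a stationary interval the bandit algorithm meets a stationary
instance, for a deterministic number of rounds. -/
theorem integral_banditRegret (E : Environment A N T σ) (B : BanditAlgorithm A) {P : ℕ}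
    (hP : A < P) {k s : ℕ} (hk : k ≤ N) (hs1 : E.ν k ≤ s + 1) :
    ∫ ω, banditRegret E B P k s ω ∂E.outcomeLaw = B.stationaryRegret (E.law (k + 1))
      (Nat.count (fun j => A ≤ j % P) (E.ν (k + 1) - 1 - s)) := by
  set n := Nat.count (fun j => A ≤ j % P) (E.ν (k + 1) - 1 - s) with hn
  have h : E.outcomeLaw.map ((fun ω => ∑ i ∈ Finset.Icc 1 n, gap (E.law (k + 1)) (B.arm ω i)) ∘
        fun ω => banditOutcome P s ω) = (outcomeLaw fun _ => E.law (k + 1)).map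
        (fun ω => ∑ i ∈ Finset.Icc 1 n, gap (E.law (k + 1)) (B.arm ω i)) :=
    map_infinitePi_reindex (S := Finset.Icc 1 n)
    (fun t => (Measure.pi fun a => (E.law (E.interval t) a : Measure ℝ)).prod
      (volume : Measure unitInterval))
    (fun _ => (Measure.pi fun a => (E.law (k + 1) a : Measure ℝ)).prod
      (volume : Measure unitInterval))
    (f := id) measurable_id (e := banditRound A P s)
    (fun i hi j hj hij => by
      simp only [Finset.coe_Icc, Set.mem_Icc] at hi hj
      have := Nat.nth_injective (infinite_setOf_le_mod hP) (Nat.add_left_cancel hij)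
      omega)
    (fun i hi => by
      rw [← Finset.mem_coe, Finset.coe_Icc] at hi
      have h := banditRound_lt (s := s) hi
      have h2 : s + 1 ≤ banditRound A P s i := Nat.le_add_right _ _
      have h3 := hi.1.trans (hi.2.trans (Nat.count_le _))
      rw [Measure.map_id, E.interval_eq hk (by omega) (by omega)])
    (measurable_sum_gap_arm B (E.law (k + 1)) n) (dependsOn_sum_gap_arm B (E.law (k + 1)) n)
  have h2 := congrArg (fun μ : Measure ℝ => ∫ x, x ∂μ) h
  beta_reduce at h2
  rw [integral_map ((measurable_sum_gap_arm B (E.law (k + 1)) n).comp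
      (measurable_banditOutcome P s)).aemeasurable (by fun_prop),
    integral_map (measurable_sum_gap_arm B (E.law (k + 1)) n).aemeasurable (by fun_prop)] at h2
  exact h2

theorem stationaryRegret_nonneg (B : BanditAlgorithm A) (P : Fin A → ProbabilityMeasure ℝ)
    (n : ℕ) : 0 ≤ B.stationaryRegret P n :=
  integral_nonneg fun _ => Finset.sum_nonneg fun _ _ => gap_nonneg _ _

theorem integral_banditRegret_le (E : Environment A N T σ) {B : BanditAlgorithm A} {C : ℝ}
    {RB : ℝ → ℝ} (hB : HasRegretBound B σ C RB)
    (hC : ∀ k ∈ Set.Icc 1 (N + 1), ∀ a, gap (E.law k) a ≤ C) {P : ℕ}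
    (hP : A < P) {k s : ℕ} (hk : k ≤ N) (hs1 : E.ν k ≤ s + 1) :
    ∫ ω, banditRegret E B P k s ω ∂E.outcomeLaw ≤ RB ((E.ν (k + 1) : ℝ) - E.ν k) := by
  have hk1 : k + 1 ∈ Set.Icc 1 (N + 1) := ⟨by omega, by omega⟩
  have hbound := hB.bound (E.law (k + 1)) (E.subGaussian _ hk1) (hC _ hk1)
  have hlt := E.ν_lt k hk
  have hlen : (1 : ℝ) ≤ (E.ν (k + 1) : ℝ) - E.ν k := by
    have : ((E.ν k + 1 : ℕ) : ℝ) ≤ E.ν (k + 1) := by exact_mod_cast hlt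
    push_cast at this
    linarith
  rw [integral_banditRegret E B hP hk hs1]
  have hcl := Nat.count_le (fun j => A ≤ j % P) (n := E.ν (k + 1) - 1 - s)
  rcases Nat.eq_zero_or_pos (Nat.count (fun j => A ≤ j % P) (E.ν (k + 1) - 1 - s)) with h0 | h0
  -- Without any round the regret is `0 ≤ RB 1`, as `RB 1` bounds the regret of a single round.
  · rw [h0]
    have h1 : B.stationaryRegret (E.law (k + 1)) 0 = 0 := by simp [BanditAlgorithm.stationaryRegret]
    have h2 : 0 ≤ RB (1 : ℕ) := (stationaryRegret_nonneg B _ 1).trans (hbound 1 le_rfl)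
    rw [h1]
    refine h2.trans (hB.mono ?_ hlen ?_)
    · simp
    · simpa using hlen
  · refine (hbound _ h0).trans (hB.mono ?_ hlen ?_)
    · rw [Set.mem_Ici]; exact_mod_cast h0
    · rw [le_sub_iff_add_le]
      exact_mod_cast (show _ + E.ν k ≤ E.ν (k + 1) by omega)

end Env

/-! ### Restarts that follow the change-points -/

section Decomposition

variable {A N T : ℕ} {σ : ℝ≥0}

/-- The times at which the restart for the `k`-th interval (from `0`) may take place when no change
was missed: at most `latencyAt A α d k` rounds of the interval are over by then. For `k = 0` the
only such time is `0`. -/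
def restartWindow (E : Environment A N T σ) (α : ℕ → ℝ) (d k : ℕ) : Finset ℕ :=
  (Finset.range (T + 1)).filter fun s =>
    E.ν k ≤ s + 1 ∧ s + 1 ≤ E.ν k + latencyAt A α d k ∧ s + 1 ≤ E.ν (k + 1)

/-- The latency of the procedure fits into the `k`-th interval (from `0`). -/
def LatencyFits (E : Environment A N T σ) (α : ℕ → ℝ) (d k : ℕ) : Prop :=
  E.ν k + latencyAt A α d k ≤ E.ν (k + 1)

open Classical in
/-- What a restart at time `s` in the `k`-th interval costs: `c` if it is followed by a false alarm
or by a missed change, and the regret of the bandit algorithm. The last change is not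
required to be detected if the latency exceeds the horizon. -/
def restartLoss (E : Environment A N T σ) (B : BanditAlgorithm A) (D : ChangeDetector)
    (α : ℕ → ℝ) (d : ℕ) (c : ℝ) (k s : ℕ) (ω : Outcome A) : ℝ :=
  c * (falseAlarm E D (period A (α (k + 1))) k s).indicator 1 ω +
    c * (if k < N ∧ LatencyFits E α d (k + 1) then
      (missedChange E D (period A (α (k + 1))) d k s).indicator 1 ω else 0) +
    banditRegret E B (period A (α (k + 1))) k s ω

theorem indicator_one_nonneg {Ω : Type*} (S : Set Ω) (ω : Ω) :
    (0 : ℝ) ≤ S.indicator (1 : Ω → ℝ) ω :=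
  Set.indicator_nonneg (fun _ _ => zero_le_one) ω

variable (E : Environment A N T σ) (B : BanditAlgorithm A) (D : ChangeDetector) (α : ℕ → ℝ) (d : ℕ)

theorem banditRegret_le_restartLoss {c : ℝ} (hc : 0 ≤ c) (k s : ℕ) (ω : Outcome A) :
    banditRegret E B (period A (α (k + 1))) k s ω ≤ restartLoss E B D α d c k s ω := by
  have h1 := mul_nonneg hc
    (indicator_one_nonneg (falseAlarm E D (period A (α (k + 1))) k s) ω)
  have h2 := mul_nonneg hc
    (indicator_one_nonneg (missedChange E D (period A (α (k + 1))) d k s) ω)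
  unfold restartLoss
  split_ifs <;> linarith

theorem restartLoss_nonneg {c : ℝ} (hc : 0 ≤ c) (k s : ℕ) (ω : Outcome A) :
    0 ≤ restartLoss E B D α d c k s ω :=
  (banditRegret_nonneg E B _ k s ω).trans (banditRegret_le_restartLoss E B D α d hc k s ω)

theorem measurable_restartLoss (c : ℝ) (k s : ℕ) : Measurable (restartLoss E B D α d c k s) := by
  have h1 : Measurable ((falseAlarm E D (period A (α (k + 1))) k s).indicator
      (1 : Outcome A → ℝ)) := measurable_one.indicator (measurableSet_falseAlarm E D _ k s)
  have h2 : Measurable ((missedChange E D (period A (α (k + 1))) d k s).indicator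
      (1 : Outcome A → ℝ)) := measurable_one.indicator (measurableSet_missedChange E D _ d k s)
  have h3 := measurable_banditRegret E B (period A (α (k + 1))) k s
  unfold restartLoss
  split_ifs <;> fun_prop

theorem dependsOn_restartLoss (c : ℝ) {k s : ℕ} (hk : k ≤ N) (hs : s < E.ν (k + 1)) :
    DependsOn (restartLoss E B D α d c k s) (Finset.Ioc s T : Finset ℕ) := by
  intro x y hxy
  have h1 := dependsOn_indicator (dependsOn_falseAlarm E D (period A (α (k + 1))) hk s) hxy
  have h3 := dependsOn_banditRegret E B (period A (α (k + 1))) hk s hxy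
  unfold restartLoss
  rw [h1, h3]
  split_ifs with hc
  · have hν := E.ν_le (k := k + 1 + 1) (by omega)
    have hfit := hc.2
    rw [LatencyFits, latencyAt, if_neg (by omega)] at hfit
    rw [dependsOn_indicator (dependsOn_missedChange E D (period A (α (k + 1))) d hs
      (hfit.trans hν)) hxy]
  · rfl

theorem integrable_indicator_one {Ω : Type*} [MeasurableSpace Ω] (μ : Measure Ω)
    [IsFiniteMeasure μ] {S : Set Ω} (hS : MeasurableSet S) :
    Integrable (S.indicator (1 : Ω → ℝ)) μ :=
  (integrable_const (1 : ℝ)).indicator hS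

theorem integrable_banditRegret (P k s : ℕ) :
    Integrable (banditRegret E B P k s) E.outcomeLaw := by
  refine integrable_finsetSum _ fun i _ => ?_
  have hm : Measurable fun ω => gap (E.law (k + 1)) (B.arm (banditOutcome P s ω) i) :=
    (measurable_of_countable (gap (E.law (k + 1)))).comp
      ((B.measurable_arm i).comp (measurable_banditOutcome P s))
  refine Integrable.of_bound hm.aestronglyMeasurable (∑ a, gap (E.law (k + 1)) a)
    (Filter.Eventually.of_forall fun ω => ?_)
  rw [Real.norm_of_nonneg (gap_nonneg _ _)]
  exact Finset.single_le_sum (f := gap (E.law (k + 1))) (fun a _ => gap_nonneg _ a)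
    (Finset.mem_univ _)

theorem integrable_restartLoss (c : ℝ) (k s : ℕ) :
    Integrable (restartLoss E B D α d c k s) E.outcomeLaw := by
  unfold restartLoss
  refine Integrable.add (Integrable.add (Integrable.const_mul ?_ c) (Integrable.const_mul ?_ c))
    (integrable_banditRegret E B _ k s)
  · exact integrable_indicator_one _ (measurableSet_falseAlarm E D _ k s)
  · split_ifs
    · exact integrable_indicator_one _ (measurableSet_missedChange E D _ d k s)
    · exact integrable_const 0

theorem integral_restartLoss_le {C c Δmin δF δD : ℝ} {m d : ℝ → ℕ} {RB : ℝ → ℝ}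
    (hC : ∀ k ∈ Set.Icc 1 (N + 1), ∀ a, gap (E.law k) a ≤ C)
    (hΔmin : 0 < Δmin) (hΔ : ∀ k ∈ Set.Icc 1 N, Δmin ≤ E.changeGap k)
    (hB : HasRegretBound B σ C RB) (hδD : 0 ≤ δD) (hc : 0 ≤ c)
    (hD : MeetsRequirements D σ δF δD T m d)
    (hP : ∀ k, 1 ≤ k → A < period A (α k))
    (hsep : ∀ k ∈ Set.Icc 1 N,
      E.ν (k - 1) + latencyAt A α (d Δmin) (k - 1) + windowAt A α (m Δmin) k ≤ E.ν k)
    {k s : ℕ} (hk : k ≤ N) (hs : s ∈ restartWindow E α (d Δmin) k) :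
    ∫ ω, restartLoss E B D α (d Δmin) c k s ω ∂E.outcomeLaw ≤
      c * (A * δF) + c * (if k < N then δD else 0) + RB ((E.ν (k + 1) : ℝ) - E.ν k) := by
  classical
  obtain ⟨-, hs1, hs2, hs3⟩ := Finset.mem_filter.1 hs
  have hPk := hP (k + 1) (by omega)
  have i1 := (integrable_indicator_one E.outcomeLaw
    (measurableSet_falseAlarm E D (period A (α (k + 1))) k s)).const_mul c
  have i2 : Integrable (fun ω => c * (if k < N ∧ LatencyFits E α (d Δmin) (k + 1) then
      (missedChange E D (period A (α (k + 1))) (d Δmin) k s).indicator (1 : Outcome A → ℝ) ω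
      else 0)) E.outcomeLaw := by
    refine Integrable.const_mul ?_ c
    split_ifs
    · exact integrable_indicator_one _ (measurableSet_missedChange E D _ _ k s)
    · exact integrable_const 0
  have i3 := integrable_banditRegret E B (period A (α (k + 1))) k s
  have i12 : Integrable (fun ω =>
      c * (falseAlarm E D (period A (α (k + 1))) k s).indicator (1 : Outcome A → ℝ) ω +
      c * (if k < N ∧ LatencyFits E α (d Δmin) (k + 1) then
        (missedChange E D (period A (α (k + 1))) (d Δmin) k s).indicator (1 : Outcome A → ℝ) ω
        else 0)) E.outcomeLaw := i1.add i2
  unfold restartLoss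
  rw [integral_add i12 i3, integral_add i1 i2, integral_const_mul, integral_const_mul,
    integral_indicator_one (measurableSet_falseAlarm E D _ k s)]
  refine add_le_add (add_le_add ?_ ?_) (integral_banditRegret_le E hB hC hPk hk hs1)
  · exact mul_le_mul_of_nonneg_left (real_falseAlarm_le E hD hPk hk hs1) hc
  · refine mul_le_mul_of_nonneg_left ?_ hc
    by_cases h : k < N ∧ LatencyFits E α (d Δmin) (k + 1)
    · simp only [if_pos h, if_pos h.1]
      rw [integral_indicator_one (measurableSet_missedChange E D _ _ k s)]
      have h1 := hsep (k + 1) ⟨by omega, h.1⟩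
      have h2 := h.2
      rw [LatencyFits, latencyAt, if_neg (by omega)] at h2
      rw [windowAt, Nat.add_sub_cancel] at h1
      exact real_missedChange_le E hD B.pos hPk h.1 hΔmin
        (hΔ _ ⟨by omega, h.1⟩) hs1 (by omega) h2
    · simp only [if_neg h, integral_zero]
      split_ifs
      · exact hδD
      · exact le_rfl

/-- The procedure restarts at most once with a given number, and what follows a restart is
independent of the past: so a bound for the expected cost of each possible restart bounds the
expected cost of the actual one. -/
theorem integral_sum_restart_le (k : ℕ) (W : Finset ℕ) (g : ℕ → Outcome A → ℝ) {b : ℝ}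
    (hb : 0 ≤ b) (hgm : ∀ s ∈ W, Measurable (g s))
    (hgd : ∀ s ∈ W, DependsOn (g s) (Finset.Ioc s T : Finset ℕ))
    (hgi : ∀ s ∈ W, Integrable (g s) E.outcomeLaw)
    (hgb : ∀ s ∈ W, ∫ ω, g s ω ∂E.outcomeLaw ≤ b) :
    Integrable (fun ω => ∑ s ∈ W, (restartEvent D α k s).indicator 1 ω * g s ω) E.outcomeLaw ∧
    ∫ ω, ∑ s ∈ W, (restartEvent D α k s).indicator 1 ω * g s ω ∂E.outcomeLaw ≤ b := by
  have hRm := fun s => measurableSet_restartEvent (A := A) D α k s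
  have hint : ∀ s ∈ W, Integrable (fun ω => (restartEvent D α k s).indicator 1 ω * g s ω)
      E.outcomeLaw := fun s hs => by
    refine ((hgi s hs).indicator (hRm s)).congr (Filter.Eventually.of_forall fun ω => ?_)
    by_cases h : ω ∈ restartEvent D α k s <;> simp [h]
  refine ⟨integrable_finsetSum _ hint, ?_⟩
  rw [integral_finsetSum _ hint]
  have hind : ∀ s ∈ W, ∫ ω, (restartEvent D α k s).indicator 1 ω * g s ω ∂E.outcomeLaw =
      E.outcomeLaw.real (restartEvent D α k s) * ∫ ω, g s ω ∂E.outcomeLaw := fun s hs =>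
    integral_indicator_mul_of_dependsOn _ (S := Finset.Iic s) (S' := Finset.Ioc s T)
      (Finset.disjoint_left.2 fun i hi hi' => by
        simp only [Finset.mem_Iic, Finset.mem_Ioc] at hi hi'; omega)
      (hRm s) (by rw [Finset.coe_Iic]; exact dependsOn_restartEvent D α k s) (hgm s hs) (hgd s hs)
  rw [Finset.sum_congr rfl hind]
  have hdisj : (W : Set ℕ).PairwiseDisjoint fun s => restartEvent (A := A) D α k s :=
    fun s _ s' _ hss => Set.disjoint_left.2 fun ω h h' => hss (restartEvent_unique h h')
  calc _ ≤ ∑ s ∈ W, E.outcomeLaw.real (restartEvent D α k s) * b :=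
        Finset.sum_le_sum fun s hs => mul_le_mul_of_nonneg_left (hgb s hs) measureReal_nonneg
    _ = E.outcomeLaw.real (⋃ s ∈ W, restartEvent D α k s) * b := by
        rw [measureReal_biUnion_finset hdisj fun s _ => hRm s, Finset.sum_mul]
    _ ≤ 1 * b := mul_le_mul_of_nonneg_right measureReal_le_one hb
    _ = b := one_mul b

/-- If no restart in the prescribed windows is followed by a false alarm or by a missed change, then
there is a restart in each window, until the latency no longer fits into the horizon. -/
theorem exists_restart {m : ℕ}
    (hsep : ∀ k ∈ Set.Icc 1 N,
      E.ν (k - 1) + latencyAt A α d (k - 1) + windowAt A α m k ≤ E.ν k)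
    {ω : Outcome A}
    (hFA : ∀ k ≤ N, ∀ s ∈ restartWindow E α d k, ω ∈ restartEvent D α k s →
      ω ∉ falseAlarm E D (period A (α (k + 1))) k s)
    (hMD : ∀ k < N, LatencyFits E α d (k + 1) → ∀ s ∈ restartWindow E α d k,
      ω ∈ restartEvent D α k s → ω ∉ missedChange E D (period A (α (k + 1))) d k s)
    {k : ℕ} (hk : k ≤ N) (hfit : LatencyFits E α d k) :
    ∃ s ∈ restartWindow E α d k, ω ∈ restartEvent D α k s := by
  induction k with
  | zero =>
    have h0 := E.ν_zero
    have h1 := E.ν_lt 0 (Nat.zero_le _)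
    refine ⟨0, ?_, rfl⟩
    simp only [restartWindow, Finset.mem_filter, Finset.mem_range]
    refine ⟨by omega, by omega, by omega, by omega⟩
  | succ k ih =>
    have hsk := hsep (k + 1) ⟨by omega, hk⟩
    rw [Nat.add_sub_cancel] at hsk
    obtain ⟨s, hs, hR⟩ := ih (by omega) (by unfold LatencyFits; omega)
    have hfa := hFA k (by omega) s hs hR
    have hmd := hMD k hk hfit s hs hR
    obtain ⟨-, hs1, hs2, hs3⟩ := Finset.mem_filter.1 hs
    rw [LatencyFits, latencyAt, if_neg (by omega)] at hfit
    have hν := E.ν_le (k := k + 1 + 1) (by omega)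
    simp only [missedChange, Set.mem_ofPred_eq, not_forall, not_not] at hmd
    classical
    have hex : ∃ j, ω ∈ alarmEvent D (period A (α (k + 1))) s j :=
      hmd.imp fun j ⟨_, hj⟩ => hj
    obtain ⟨j₀, hj₀, hj₀'⟩ := hmd
    have hle := (Nat.find_min' hex hj₀').trans_lt hj₀
    have hge : E.ν (k + 1) - 1 - s ≤ Nat.find hex := by
      by_contra hc
      exact hfa ⟨_, not_le.1 hc, Nat.find_spec hex⟩
    refine ⟨s + 1 + Nat.find hex, ?_, s, _, rfl, hR, Nat.find_spec hex,
      fun i hi => Nat.find_min hex hi⟩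
    simp only [restartWindow, Finset.mem_filter, Finset.mem_range]
    have hlat : latencyAt A α d (k + 1) = period A (α (k + 1)) * d := if_neg (by omega)
    refine ⟨by omega, by omega, by omega, by omega⟩

/-- Regret in the `k`-th interval (from `0`): the rounds until the restart cost `C` each, and so do
those of forced exploration. -/
theorem interval_regret_le {C : ℝ} (hα : ∀ k, 1 ≤ k → α k ∈ Set.Ioo (0 : ℝ) 1)
    {ω : Outcome A} {k : ℕ} (hC : ∀ a, gap (E.law (k + 1)) a ≤ C) (hC0 : 0 ≤ C) (hk : k ≤ N)
    (hFA : ∀ s ∈ restartWindow E α d k, ω ∈ restartEvent D α k s →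
      ω ∉ falseAlarm E D (period A (α (k + 1))) k s)
    (hR : LatencyFits E α d k → ∃ s ∈ restartWindow E α d k, ω ∈ restartEvent D α k s) :
    ∑ t ∈ Finset.Ico (E.ν k) (E.ν (k + 1)), gap (E.law (k + 1)) (armAt B D α ω t) ≤
      ∑ s ∈ restartWindow E α d k, (restartEvent D α k s).indicator 1 ω *
        banditRegret E B (period A (α (k + 1))) k s ω +
      C * latencyAt A α d k + C * (α (k + 1) * ((E.ν (k + 1) : ℝ) - E.ν k) + A) := by
  have hαk := hα (k + 1) (by omega)
  have hlt := E.ν_lt k hk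
  have hltR : (E.ν k : ℝ) < E.ν (k + 1) := by exact_mod_cast hlt
  have hterm : ∀ s ∈ restartWindow E α d k, 0 ≤ (restartEvent D α k s).indicator 1 ω *
      banditRegret E B (period A (α (k + 1))) k s ω := fun s _ =>
    mul_nonneg (indicator_one_nonneg _ _) (banditRegret_nonneg E B _ k s ω)
  have hcard : ∀ u v : ℕ, ∑ t ∈ Finset.Ico u v, gap (E.law (k + 1)) (armAt B D α ω t) ≤
      C * (v - u : ℕ) := fun u v => by
    refine (Finset.sum_le_card_nsmul _ _ C fun t _ => hC _).trans_eq ?_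
    rw [Nat.card_Ico, nsmul_eq_mul, mul_comm]
  by_cases hfit : LatencyFits E α d k
  · obtain ⟨s, hs, hsR⟩ := hR hfit
    obtain ⟨-, hs1, hs2, hs3⟩ := Finset.mem_filter.1 hs
    have hfa := hFA s hs hsR
    have hst := state_of_mem_restartEvent B D α (fun k hk => lt_period B.pos (hα k hk)) hsR
    rw [← Finset.sum_Ico_consecutive _ hs1 hs3]
    have h1 : ∑ t ∈ Finset.Ico (E.ν k) (s + 1), gap (E.law (k + 1)) (armAt B D α ω t) ≤
        C * latencyAt A α d k := (hcard _ _).trans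
      (mul_le_mul_of_nonneg_left (by exact_mod_cast (by omega)) hC0)
    have hn : E.ν (k + 1) - (s + 1) = E.ν (k + 1) - 1 - s := by omega
    have h2 := sum_gap_le B D α ω (lt_period B.pos hαk) hst (n := E.ν (k + 1) - 1 - s)
      (fun j hj hal => hfa ⟨j, hj, hal⟩) (gap (E.law (k + 1))) hC
    have h3 := Finset.single_le_sum hterm hs
    have h4 := forced_count_le hαk B.pos (E.ν (k + 1) - 1 - s)
    have h5 : ((E.ν (k + 1) - 1 - s : ℕ) : ℝ) ≤ (E.ν (k + 1) : ℝ) - E.ν k := by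
      rw [le_sub_iff_add_le]
      exact_mod_cast (by omega)
    have h6 := mul_le_mul_of_nonneg_left
      (h4.trans (add_le_add_left (mul_le_mul_of_nonneg_left h5 hαk.1.le) _)) hC0
    rw [Set.indicator_of_mem hsR, Pi.one_apply, one_mul, banditRegret] at h3
    have h7 := Finset.sum_Ico_eq_sum_range
      (fun t => gap (E.law (k + 1)) (armAt B D α ω t)) (s + 1) (E.ν (k + 1))
    rw [hn] at h7
    linarith
  · have h1 : C * ((E.ν (k + 1) - E.ν k : ℕ) : ℝ) ≤ C * latencyAt A α d k := by
      refine mul_le_mul_of_nonneg_left ?_ hC0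
      unfold LatencyFits at hfit
      exact_mod_cast (by omega)
    have h2 := Finset.sum_nonneg hterm
    have h3 : 0 ≤ α (k + 1) * ((E.ν (k + 1) : ℝ) - E.ν k) := mul_nonneg hαk.1.le (by linarith)
    have h4 : 0 ≤ C * (α (k + 1) * ((E.ν (k + 1) : ℝ) - E.ν k) + A) := by positivity
    have h5 := hcard (E.ν k) (E.ν (k + 1))
    linarith

theorem sum_length : ∑ k ∈ Finset.range (N + 1), ((E.ν (k + 1) : ℝ) - E.ν k) = T := by
  rw [Finset.sum_range_sub (fun k => (E.ν k : ℝ)), E.ν_zero, E.ν_last]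
  push_cast
  ring

/-- Regret of the procedure for one realization: either some restart in its window is followed by
a false alarm or a missed change, and its cost exceeds the largest possible regret, or
all restarts follow the change-points and the regret can be bounded interval by interval. -/
theorem sum_regret_le {C : ℝ} (hα : ∀ k, 1 ≤ k → α k ∈ Set.Ioo (0 : ℝ) 1) {m : ℕ}
    (hsep : ∀ k ∈ Set.Icc 1 N,
      E.ν (k - 1) + latencyAt A α d (k - 1) + windowAt A α m k ≤ E.ν k)
    (hC : ∀ k ∈ Set.Icc 1 (N + 1), ∀ a, gap (E.law k) a ≤ C) (hC0 : 0 ≤ C) (ω : Outcome A) :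
    ∑ k ∈ Finset.range (N + 1), ∑ t ∈ Finset.Ico (E.ν k) (E.ν (k + 1)),
        gap (E.law (k + 1)) (armAt B D α ω t) ≤
      ∑ k ∈ Finset.range (N + 1), (∑ s ∈ restartWindow E α d k,
          (restartEvent D α k s).indicator 1 ω * restartLoss E B D α d (C * T) k s ω +
        (C * latencyAt A α d k + C * (α (k + 1) * ((E.ν (k + 1) : ℝ) - E.ν k) + A))) := by
  have hCT : 0 ≤ C * (T : ℝ) := by positivity
  have hterm : ∀ k s, 0 ≤ (restartEvent D α k s).indicator 1 ω *
      restartLoss E B D α d (C * T) k s ω := fun k s =>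
    mul_nonneg (indicator_one_nonneg _ _) (restartLoss_nonneg E B D α d hCT k s ω)
  have hlen : ∀ k ≤ N, (E.ν k : ℝ) ≤ E.ν (k + 1) := fun k hk => by exact_mod_cast (E.ν_lt k hk).le
  have hrest : ∀ k ≤ N, 0 ≤ C * latencyAt A α d k +
      C * (α (k + 1) * ((E.ν (k + 1) : ℝ) - E.ν k) + A) := fun k hk => by
    have h1 := (hα (k + 1) (by omega)).1.le
    have h2 := sub_nonneg.2 (hlen k hk)
    positivity
  by_cases hgood : ∀ k ≤ N, ∀ s ∈ restartWindow E α d k, ω ∈ restartEvent D α k s →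
      ω ∉ falseAlarm E D (period A (α (k + 1))) k s ∧
      (k < N → LatencyFits E α d (k + 1) →
        ω ∉ missedChange E D (period A (α (k + 1))) d k s)
  · refine Finset.sum_le_sum fun k hk => ?_
    have hk : k ≤ N := by have := Finset.mem_range.1 hk; omega
    have h := interval_regret_le E B D α d hα (hC (k + 1) ⟨by omega, by omega⟩) hC0 hk
      (fun s hs hR => (hgood k hk s hs hR).1)
      (exists_restart E D α d hsep (fun k hk s hs hR => (hgood k hk s hs hR).1)
        (fun k hk hf s hs hR => (hgood k hk.le s hs hR).2 hk hf) hk)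
    rw [← add_assoc]
    refine h.trans (add_le_add_left (add_le_add_left ?_ _) _)
    exact Finset.sum_le_sum fun s _ => mul_le_mul_of_nonneg_left
      (banditRegret_le_restartLoss E B D α d hCT k s ω) (indicator_one_nonneg _ _)
  · push Not at hgood
    obtain ⟨k, hk, s, hs, hR, hbad⟩ := hgood
    have hloss : C * T ≤ restartLoss E B D α d (C * T) k s ω := by
      have hb := banditRegret_nonneg E B (period A (α (k + 1))) k s ω
      by_cases hfa : ω ∈ falseAlarm E D (period A (α (k + 1))) k s
      · have hm := mul_nonneg hCT
          (indicator_one_nonneg (missedChange E D (period A (α (k + 1))) d k s) ω)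
        unfold restartLoss
        rw [Set.indicator_of_mem hfa, Pi.one_apply]
        split_ifs <;> linarith
      · obtain ⟨hkN, hfit, hmd⟩ := hbad hfa
        unfold restartLoss
        rw [Set.indicator_of_notMem hfa, if_pos ⟨hkN, hfit⟩, Set.indicator_of_mem hmd,
          Pi.one_apply]
        linarith
    calc _ ≤ ∑ k ∈ Finset.range (N + 1), C * ((E.ν (k + 1) : ℝ) - E.ν k) := by
          refine Finset.sum_le_sum fun k hk => ?_
          have hk : k ≤ N := by have := Finset.mem_range.1 hk; omega
          refine (Finset.sum_le_card_nsmul _ _ C fun t _ =>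
            hC (k + 1) ⟨by omega, by omega⟩ _).trans_eq ?_
          rw [Nat.card_Ico, nsmul_eq_mul, mul_comm, Nat.cast_sub (E.ν_lt k hk).le]
      _ = C * T := by rw [← Finset.mul_sum, sum_length]
      _ ≤ (restartEvent D α k s).indicator 1 ω * restartLoss E B D α d (C * T) k s ω := by
          rwa [Set.indicator_of_mem hR, Pi.one_apply, one_mul]
      _ ≤ ∑ s ∈ restartWindow E α d k, (restartEvent D α k s).indicator 1 ω *
            restartLoss E B D α d (C * T) k s ω :=
          Finset.single_le_sum (fun s _ => hterm k s) hs
      _ ≤ _ := le_add_of_nonneg_right (hrest k hk)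
      _ ≤ _ := Finset.single_le_sum (f := fun k => ∑ s ∈ restartWindow E α d k,
            (restartEvent D α k s).indicator 1 ω * restartLoss E B D α d (C * T) k s ω +
            (C * latencyAt A α d k + C * (α (k + 1) * ((E.ν (k + 1) : ℝ) - E.ν k) + A)))
          (fun k hk => add_nonneg (Finset.sum_nonneg fun s _ => hterm k s)
            (hrest k (by have := Finset.mem_range.1 hk; omega)))
          (Finset.mem_range.2 (by omega))

/-! ### Summation over the stationary intervals -/

theorem sum_Icc_one_eq_sum_range (f : ℕ → ℝ) (n : ℕ) :
    ∑ k ∈ Finset.Icc 1 n, f k = ∑ k ∈ Finset.range n, f (k + 1) := by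
  induction n with
  | zero => simp
  | succ n ih => rw [Finset.sum_Icc_succ_top (by omega), ih, Finset.sum_range_succ]

theorem sum_regretBound_le {RB : ℝ → ℝ} (hRB : ConcaveOn ℝ (Set.Ici 1) RB) :
    ∑ k ∈ Finset.range (N + 1), RB ((E.ν (k + 1) : ℝ) - E.ν k) ≤
      (N + 1) * RB ((T : ℝ) / (N + 1)) := by
  have hN : (0 : ℝ) < N + 1 := by positivity
  have h := hRB.le_map_sum (t := Finset.range (N + 1)) (w := fun _ => (1 : ℝ) / (N + 1))
    (p := fun k => (E.ν (k + 1) : ℝ) - E.ν k) (fun _ _ => by positivity)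
    (by
      rw [Finset.sum_const, Finset.card_range, nsmul_eq_mul]
      push_cast
      field_simp)
    (fun k hk => by
      have : ((E.ν k + 1 : ℕ) : ℝ) ≤ E.ν (k + 1) := by
        exact_mod_cast E.ν_lt k (by have := Finset.mem_range.1 hk; omega)
      push_cast at this
      rw [Set.mem_Ici]
      linarith)
  simp only [smul_eq_mul] at h
  rw [← Finset.mul_sum, ← Finset.mul_sum, sum_length, one_div_mul_eq_div, one_div_mul_eq_div,
    div_le_iff₀ hN] at h
  linarith

end Decomposition

end DAB

end

theorem theorem3 (A N T : ℕ) (σ : ℝ≥0) (C Δmin δF δD : ℝ)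
    (E : DAB.Environment A N T σ)
    (hC : ∀ k ∈ Set.Icc 1 (N + 1), ∀ a, DAB.gap (E.law k) a ≤ C)
    (hΔmin : 0 < Δmin) (hΔ : ∀ k ∈ Set.Icc 1 N, Δmin ≤ E.changeGap k)
    (B : DAB.BanditAlgorithm A) (RB : ℝ → ℝ) (hB : DAB.HasRegretBound B σ C RB)
    (hδF : δF ∈ Set.Ioo (0 : ℝ) 1) (hδD : δD ∈ Set.Ioo (0 : ℝ) 1)
    (D : DAB.ChangeDetector) (m d : ℝ → ℕ) (hD : DAB.MeetsRequirements D σ δF δD T m d)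
    (α : ℕ → ℝ) (hα : ∀ k, 1 ≤ k → α k ∈ Set.Ioo (0 : ℝ) 1)
    (hsep : ∀ k ∈ Set.Icc 1 N,
      E.ν (k - 1) + DAB.latencyAt A α (d Δmin) (k - 1) + DAB.windowAt A α (m Δmin) k ≤ E.ν k) :
    DAB.regret E B D α ≤
      C * T * A * (N + 1) * δF + C * T * N * δD + (N + 1) * RB ((T : ℝ) / (N + 1))
        + C * ∑ k ∈ Finset.Icc 1 N, (DAB.latencyAt A α (d Δmin) k : ℝ)
        + C * (DAB.maxFreq α N * T + (N + 1) * A) := by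
  open DAB in
  have hA := B.pos
  have hC0 : 0 ≤ C := (gap_nonneg _ _).trans (hC 1 ⟨le_rfl, by omega⟩ ⟨0, hA⟩)
  have hCT : 0 ≤ C * (T : ℝ) := by positivity
  have hlen : ∀ k ≤ N, (1 : ℝ) ≤ (E.ν (k + 1) : ℝ) - E.ν k := fun k hk => by
    have : ((E.ν k + 1 : ℕ) : ℝ) ≤ E.ν (k + 1) := by exact_mod_cast E.ν_lt k hk
    push_cast at this
    linarith
  have hRB0 : ∀ k ≤ N, 0 ≤ RB ((E.ν (k + 1) : ℝ) - E.ν k) := fun k hk => by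
    have hk1 : k + 1 ∈ Set.Icc 1 (N + 1) := ⟨by omega, by omega⟩
    have h := (stationaryRegret_nonneg B (E.law (k + 1)) 1).trans
      (hB.bound _ (E.subGaussian _ hk1) (hC _ hk1) 1 le_rfl)
    rw [Nat.cast_one] at h
    exact h.trans (hB.mono (Set.mem_Ici.2 le_rfl) (hlen k hk) (hlen k hk))
  let b : ℕ → ℝ := fun k => C * T * (A * δF) + C * T * (if k < N then δD else 0) +
    RB ((E.ν (k + 1) : ℝ) - E.ν k)
  have hδF0 := hδF.1.le
  have hδD0 := hδD.1.le
  have hb : ∀ k ≤ N, 0 ≤ b k := fun k hk => by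
    have h1 := hRB0 k hk
    have h2 : (0 : ℝ) ≤ if k < N then δD else 0 := by split_ifs <;> linarith
    positivity
  have hpart : ∀ k ∈ Finset.range (N + 1), _ := fun k hk =>
    integral_sum_restart_le E D α k (restartWindow E α (d Δmin) k)
      (restartLoss E B D α (d Δmin) (C * T) k) (hb k (by have := Finset.mem_range.1 hk; omega))
      (fun s _ => measurable_restartLoss E B D α _ _ k s)
      (fun s hs => dependsOn_restartLoss E B D α _ _ (by have := Finset.mem_range.1 hk; omega)
        (Finset.mem_filter.1 hs).2.2.2)
      (fun s _ => integrable_restartLoss E B D α _ _ k s)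
      (fun s hs => integral_restartLoss_le E B D α hC hΔmin hΔ hB hδD0 hCT hD
        (fun k hk => lt_period hA (hα k hk)) hsep (by have := Finset.mem_range.1 hk; omega) hs)
  have hint : ∀ k ∈ Finset.range (N + 1), Integrable (fun ω => ∑ s ∈ restartWindow E α (d Δmin) k,
      (restartEvent D α k s).indicator 1 ω * restartLoss E B D α (d Δmin) (C * T) k s ω +
      (C * latencyAt A α (d Δmin) k + C * (α (k + 1) * ((E.ν (k + 1) : ℝ) - E.ν k) + A)))
      E.outcomeLaw := fun k hk => (hpart k hk).1.add (integrable_const _)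
  have hreg : regret E B D α ≤ ∑ k ∈ Finset.range (N + 1), (b k +
      (C * latencyAt A α (d Δmin) k + C * (α (k + 1) * ((E.ν (k + 1) : ℝ) - E.ν k) + A))) := by
    unfold regret
    -- The integrand is nonnegative, so that only its upper bound has to be integrable.
    refine (integral_mono_of_nonneg (Filter.Eventually.of_forall fun ω =>
      Finset.sum_nonneg fun k _ => Finset.sum_nonneg fun t _ => gap_nonneg _ _)
      (integrable_finsetSum _ hint) (Filter.Eventually.of_forall fun ω => ?_)).trans ?_
    · simp only
      rw [sum_Icc_one_eq_sum_range]
      exact sum_regret_le E B D α (d Δmin) hα hsep hC hC0 ω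
    · rw [integral_finsetSum _ hint]
      refine Finset.sum_le_sum fun k hk => ?_
      rw [integral_add (hpart k hk).1 (integrable_const _), integral_const, probReal_univ, one_smul]
      exact add_le_add_left (hpart k hk).2 _
  refine hreg.trans ?_
  have hmax : ∑ k ∈ Finset.range (N + 1), α (k + 1) * ((E.ν (k + 1) : ℝ) - E.ν k) ≤
      maxFreq α N * T := by
    rw [← sum_length E, Finset.mul_sum]
    refine Finset.sum_le_sum fun k hk => ?_
    have hk := Finset.mem_range.1 hk
    refine mul_le_mul_of_nonneg_right ?_ (by linarith [hlen k (by omega)])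
    exact Finset.le_sup' α (Finset.mem_Icc.2 ⟨by omega, by omega⟩)
  have hlat : ∑ k ∈ Finset.range (N + 1), (latencyAt A α (d Δmin) k : ℝ) =
      ∑ k ∈ Finset.Icc 1 N, (latencyAt A α (d Δmin) k : ℝ) := by
    rw [Finset.sum_range_succ', sum_Icc_one_eq_sum_range]
    simp [latencyAt]
  have hδ : ∑ k ∈ Finset.range (N + 1), (if k < N then δD else 0) = N * δD := by
    rw [Finset.sum_range_succ, if_neg (lt_irrefl N), add_zero,
      Finset.sum_congr rfl fun k hk => if_pos (Finset.mem_range.1 hk)]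
    simp
  have hJ := sum_regretBound_le E hB.concave
  simp only [b, Finset.sum_add_distrib, ← Finset.mul_sum, Finset.sum_const, Finset.card_range,
    nsmul_eq_mul, hlat, hδ]
  push_cast
  have := mul_le_mul_of_nonneg_left hmax hC0
  linarith
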